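/- Let $N\ge 3$ and $0\le\alpha<\beta\le 1$. Let $\Omega=\{x\in\mathbb R^N:\alpha<|x|<\beta\}$ if $\alpha>0$ and $\Omega=\{x\in\mathbb R^N:|x|<\beta\}$ if $\alpha=0$. Let $\mathcal C_+$ be the set of radial functions $u=u(|x|)\in H^1(\Omega)$ that are nonnegative and nondecreasing in $r=|x|$ (identified with their continuous representatives on $[\alpha,\beta]$). For $p>1$ and $u\not\equiv0$ put $$Q_p(u)=\frac{\int_\Omega(|\nabla u|^2+u^2)\,dx}{\left(\int_\Omega |u|^{p+1}\,dx\right)^{2/(p+1)}},\qquad c_{p,+}=\inf\{Q_p(u):\ u\in\mathcal C_+,\ u\not\equiv 0,\ \|u\|_{L^\infty(\Omega)}<\sqrt e+1\}.$$ Denote by $u_{p,+}$ any function in $\mathcal C_+$ that is a classical solution of $$-(r^{N-1}u')'+r^{N-1}u=r^{N-1}u^p\ \text{ in }(\alpha,\beta),\qquad u'(\alpha)=u'(\beta)=0,$$ that is, a radial solution of $-\Delta u+u=u^p$ in $\Omega$ with $\partial_\nu u=0$ on $\partial\Omega$, and a positive multiple of which belongs to the set of admissible functions in the definition of $c_{p,+}$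 and achieves $c_{p,+}$. Then there is $p_0=p_0(N,\alpha,\beta)>1$ such that for every real $p>p_0$, every such $u_{p,+}$ is nondegenerate among radial functions: if $v$ is a classical solution of $$-(r^{N-1}v')'+r^{N-1}v=r^{N-1}\,p\,u_{p,+}^{p-1}\,v\ \text{ in }(\alpha,\beta),\qquad v'(\alpha)=v'(\beta)=0,$$ then $v\equiv0$ on $[\alpha,\beta]$. -/

import Mathlib

open Set MeasureTheory
open scoped ENNReal ContDiff

noncomputable section

namespace RadialNeumann

/-- The annulus `{α < |x| < β}` in `ℝ^N` if `0 < α`, and the full ball `{|x| < β}` if `α = 0`. -/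
def annulus (N : ℕ) (α β : ℝ) : Set (EuclideanSpace ℝ (Fin N)) :=
  {x | (0 < α → α < ‖x‖) ∧ ‖x‖ < β}

/-- The radial function `x ↦ u(|x|)` on `ℝ^N` with profile `u`. -/
def radial (N : ℕ) (u : ℝ → ℝ) : EuclideanSpace ℝ (Fin N) → ℝ := fun x => u ‖x‖

/-- `g` is a weak gradient of `f` in `Ω`. -/
def IsWeakGradient {N : ℕ} (Ω : Set (EuclideanSpace ℝ (Fin N)))
    (f : EuclideanSpace ℝ (Fin N) → ℝ)
    (g : EuclideanSpace ℝ (Fin N) → EuclideanSpace ℝ (Fin N)) : Prop :=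
  ∀ φ : EuclideanSpace ℝ (Fin N) → ℝ, ContDiff ℝ ∞ φ → HasCompactSupport φ → tsupport φ ⊆ Ω →
    ∀ e : EuclideanSpace ℝ (Fin N),
      ∫ x in Ω, f x * fderiv ℝ φ x e = -∫ x in Ω, inner ℝ (g x) e * φ x

/-- `f` lies in `L²(Ω)` and has the weak gradient `g ∈ L²(Ω)`. -/
def IsH1Pair {N : ℕ} (Ω : Set (EuclideanSpace ℝ (Fin N)))
    (f : EuclideanSpace ℝ (Fin N) → ℝ)
    (g : EuclideanSpace ℝ (Fin N) → EuclideanSpace ℝ (Fin N)) : Prop :=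
  MemLp f 2 (volume.restrict Ω) ∧ MemLp g 2 (volume.restrict Ω) ∧ IsWeakGradient Ω f g

/-- Membership in the Sobolev space `H¹(Ω)`. -/
def MemH1 {N : ℕ} (Ω : Set (EuclideanSpace ℝ (Fin N)))
    (f : EuclideanSpace ℝ (Fin N) → ℝ) : Prop :=
  ∃ g, IsH1Pair Ω f g

open Classical in
/-- The weak gradient of `f ∈ H¹(Ω)` (unique almost everywhere in `Ω`); `0` if `f ∉ H¹(Ω)`. -/
def weakGrad {N : ℕ} (Ω : Set (EuclideanSpace ℝ (Fin N)))
    (f : EuclideanSpace ℝ (Fin N) → ℝ) :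
    EuclideanSpace ℝ (Fin N) → EuclideanSpace ℝ (Fin N) :=
  if h : MemH1 Ω f then h.choose else 0

/-- `‖f‖²_{H¹(Ω)} = ∫_Ω (|∇f|² + f²)`. -/
def H1NormSq {N : ℕ} (Ω : Set (EuclideanSpace ℝ (Fin N)))
    (f : EuclideanSpace ℝ (Fin N) → ℝ) : ℝ :=
  ∫ x in Ω, (‖weakGrad Ω f x‖ ^ 2 + f x ^ 2)

/-- `‖f‖_{L^q(Ω)}` for a finite exponent `q`. -/
def LNorm {N : ℕ} (Ω : Set (EuclideanSpace ℝ (Fin N))) (q : ℝ)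
    (f : EuclideanSpace ℝ (Fin N) → ℝ) : ℝ :=
  (∫ x in Ω, |f x| ^ q) ^ (1 / q)

/-- The quotient `Q_{p,[α,β]}(u) = ‖u‖²_{H¹} / ‖u‖²_{p+1}` of the radial function with profile
`u`. -/
def Q (N : ℕ) (α β p : ℝ) (u : ℝ → ℝ) : ℝ :=
  H1NormSq (annulus N α β) (radial N u) / LNorm (annulus N α β) (p + 1) (radial N u) ^ 2

/-- The cone of nonnegative, radially nondecreasing functions in `H¹_rad`; as usual its elements
are identified with their continuous representatives on `[α, β]`. -/
structure MemCone (N : ℕ) (α β : ℝ) (u : ℝ → ℝ) : Prop where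
  memH1 : MemH1 (annulus N α β) (radial N u)
  continuousOn : ContinuousOn u (Icc α β)
  nonneg : ∀ r ∈ Icc α β, 0 ≤ u r
  monotoneOn : MonotoneOn u (Icc α β)

/-- Admissible functions in the minimization of `Q`: elements `u ≢ 0` of the cone
with `‖u‖_∞ < √e + 1`. -/
def admissible (N : ℕ) (α β : ℝ) : Set (ℝ → ℝ) :=
  {u | MemCone N α β u ∧ (∃ r ∈ Icc α β, u r ≠ 0) ∧
    eLpNorm (radial N u) ∞ (volume.restrict (annulus N α β)) <
      ENNReal.ofReal (√(Real.exp 1) + 1)}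

/-- The minimal level `c_{p,+}(α,β)`. -/
def cPlus (N : ℕ) (α β p : ℝ) : ℝ :=
  sInf (Q N α β p '' admissible N α β)

/-- `w` is a classical solution of
`-(r^{N-1} w')' + r^{N-1} w = r^{N-1} f` in `(α, β)`, `w'(α) = w'(β) = 0`
(one-sided derivatives at the endpoints). -/
structure SolvesRadialNeumann (N : ℕ) (α β : ℝ) (f w : ℝ → ℝ) : Prop where
  differentiableAt : ∀ r ∈ Ioo α β, DifferentiableAt ℝ w r
  differentiableAt_flux :
    ∀ r ∈ Ioo α β, DifferentiableAt ℝ (fun s => s ^ (N - 1) * deriv w s) r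
  equation : ∀ r ∈ Ioo α β,
    -deriv (fun s => s ^ (N - 1) * deriv w s) r + r ^ (N - 1) * w r = r ^ (N - 1) * f r
  neumann_left : HasDerivWithinAt w 0 (Icc α β) α
  neumann_right : HasDerivWithinAt w 0 (Icc α β) β

/-- `u` is an increasing solution `u_{p,+}(·;α,β)`: it lies in the cone, it is a radial solution
of `-Δu + u = u^p` with Neumann boundary conditions, and a positive multiple of it
achieves `c_{p,+}(α,β)`. -/
structure IsIncreasingSolution (N : ℕ) (α β p : ℝ) (u : ℝ → ℝ) : Prop where
  memCone : MemCone N α β u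
  solves : SolvesRadialNeumann N α β (fun r => u r ^ p) u
  achieves : ∃ t : ℝ, 0 < t ∧ (fun r => t * u r) ∈ admissible N α β ∧
    Q N α β p (fun r => t * u r) = cPlus N α β p

end RadialNeumann

end

/-! Minimality of u serves only to exclude u ≡ 1: for large p every nondecreasing solution that
crosses the value 1 is nondegenerate (`exists_forall_kernel_eq_zero`). The constant is excluded
since a suitable profile 1 - ε(β² - r²) has smaller H¹ norm than 1 but the same supremum, and
L^{p+1} norms approach suprema as p → ∞ (`exists_forall_cPlus_lt`).

Write n = N - 1. Such a solution has a boundary layer at β. The energy u'²/2 + u^{p+1}/(p+1) - u²/2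
is nonincreasing and starts nonpositive, so u' ≤ u ≤ 2 and u^{p-1} ≤ (p+1)/2. The flux r^n u' rises
up to the point S where u = 1 and falls after it. One gets β - S = O(p^{-1/2}) (`sub_sq_le`) and a
lower bound, independent of p, for the flux at S (`lt_one_sub`, `le_flux`). Little energy is lost on
[S, β], so u(β)^p ≥ bp (`le_rpow_right`).

Let v be a kernel element and V = max |v|. Differentiating the equation shows that W = r^n(u'v' -
u''v) satisfies W' = -n r^{n-2} u'v, hence |W| ≤ CV. At β one has u' = 0 and u'' ≤ -bp/2, so |v(β)|
≤ CV/p. On the layer [β - κ/p, β] the potential is O(p²) and v is at most twice |v(β)|. On [β - δ, β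
- κ/p] the flux is bounded below, and (v/u')' = W/(r^n u'²) transports the bound with an error of
order δV. To the left p u^{p-1} ≤ 1, so v² is nondecreasing. Altogether V ≤ V/2, so V = 0. -/

namespace RadialNeumann

/-! ### Mean value inequalities -/

section MeanValue

variable {a b C : ℝ} {f f' : ℝ → ℝ}

theorem mul_sub_le_sub_of_le_hasDerivAt (hab : a ≤ b) (hc : ContinuousOn f (Icc a b))
    (hd : ∀ x ∈ Ioo a b, HasDerivAt f (f' x) x) (h : ∀ x ∈ Ioo a b, C ≤ f' x) :
    C * (b - a) ≤ f b - f a := by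
  rcases hab.eq_or_lt with rfl | hab
  · simp
  obtain ⟨x, hx, hxe⟩ := exists_hasDerivAt_eq_slope f f' hab hc hd
  have h1 := h x hx
  rw [hxe, le_div_iff₀ (by linarith)] at h1
  exact h1

theorem sub_le_mul_sub_of_hasDerivAt_le (hab : a ≤ b) (hc : ContinuousOn f (Icc a b))
    (hd : ∀ x ∈ Ioo a b, HasDerivAt f (f' x) x) (h : ∀ x ∈ Ioo a b, f' x ≤ C) :
    f b - f a ≤ C * (b - a) := by
  rcases hab.eq_or_lt with rfl | hab
  · simp
  obtain ⟨x, hx, hxe⟩ := exists_hasDerivAt_eq_slope f f' hab hc hd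
  have h1 := h x hx
  rw [hxe, div_le_iff₀ (by linarith)] at h1
  exact h1

theorem abs_sub_le_mul_sub_of_abs_hasDerivAt_le (hab : a ≤ b) (hc : ContinuousOn f (Icc a b))
    (hd : ∀ x ∈ Ioo a b, HasDerivAt f (f' x) x) (h : ∀ x ∈ Ioo a b, |f' x| ≤ C) :
    |f b - f a| ≤ C * (b - a) := by
  rw [abs_le]
  constructor
  · have := mul_sub_le_sub_of_le_hasDerivAt (C := -C) hab hc hd
      fun x hx => (abs_le.1 (h x hx)).1
    linarith
  · exact sub_le_mul_sub_of_hasDerivAt_le hab hc hd fun x hx => (abs_le.1 (h x hx)).2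

theorem le_of_hasDerivAt_nonneg (hab : a ≤ b) (hc : ContinuousOn f (Icc a b))
    (hd : ∀ x ∈ Ioo a b, HasDerivAt f (f' x) x) (h : ∀ x ∈ Ioo a b, 0 ≤ f' x) : f a ≤ f b := by
  have := mul_sub_le_sub_of_le_hasDerivAt hab hc hd h
  linarith

theorem le_of_hasDerivAt_nonpos (hab : a ≤ b) (hc : ContinuousOn f (Icc a b))
    (hd : ∀ x ∈ Ioo a b, HasDerivAt f (f' x) x) (h : ∀ x ∈ Ioo a b, f' x ≤ 0) : f b ≤ f a := by
  have := sub_le_mul_sub_of_hasDerivAt_le hab hc hd h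
  linarith

end MeanValue

/-! ### Classical solutions up to the endpoints -/

/-- `w` solves `-(r^n w')' + r^n w = r^n f` on `(α, β)`, and its derivative there extends
to the continuous function `z` on `[α, β]`, which vanishes at both endpoints. -/
structure Flow (n : ℕ) (α β : ℝ) (f w z : ℝ → ℝ) : Prop where
  cont : ContinuousOn w (Icc α β)
  cont_deriv : ContinuousOn z (Icc α β)
  left : z α = 0
  right : z β = 0
  hasDeriv : ∀ r ∈ Ioo α β, HasDerivAt w (z r) r
  hasDeriv_deriv : ∀ r ∈ Ioo α β, HasDerivAt z (w r - f r - n / r * z r) r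

/-- A function with vanishing one-sided derivative at the left endpoint has arbitrarily small
derivatives nearby. -/
theorem exists_abs_deriv_le_left {w : ℝ → ℝ} {α β r η : ℝ}
    (hd : ∀ x ∈ Ioo α β, DifferentiableAt ℝ w x) (h : HasDerivWithinAt w 0 (Icc α β) α)
    (hr : r ∈ Ioo α β) (hη : 0 < η) : ∃ s ∈ Ioo α r, |deriv w s| ≤ η := by
  have h2 := (hasDerivWithinAt_iff_isLittleO.1 h).def hη
  have h3 : Icc α β ∈ nhdsWithin α (Ioi α) :=
    Icc_mem_nhdsGT (hr.1.trans hr.2)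
  have h4 := (nhdsWithin_le_iff.2 h3) h2
  obtain ⟨t, ht, htr⟩ := (Filter.Eventually.and h4 (Ioo_mem_nhdsGT hr.1)).exists
  have hc : ContinuousOn w (Icc α t) := by
    intro x hx
    rcases hx.1.eq_or_lt with rfl | h5
    · exact h.continuousWithinAt.mono (Icc_subset_Icc le_rfl (by linarith [htr.2, hr.2]))
    · exact (hd x ⟨h5, by linarith [hx.2, htr.2, hr.2]⟩).continuousAt.continuousWithinAt
  obtain ⟨s, hs, hse⟩ := exists_deriv_eq_slope w htr.1 hc fun x hx =>
    (hd x ⟨hx.1, by linarith [hx.2, htr.2, hr.2]⟩).differentiableWithinAt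
  refine ⟨s, ⟨hs.1, hs.2.trans htr.2⟩, ?_⟩
  have hpos : 0 < t - α := by linarith [htr.1]
  rw [hse, abs_div, abs_of_pos hpos, div_le_iff₀ hpos]
  simpa [abs_of_pos hpos] using ht

theorem exists_abs_deriv_le_right {w : ℝ → ℝ} {α β r η : ℝ}
    (hd : ∀ x ∈ Ioo α β, DifferentiableAt ℝ w x) (h : HasDerivWithinAt w 0 (Icc α β) β)
    (hr : r ∈ Ioo α β) (hη : 0 < η) : ∃ s ∈ Ioo r β, |deriv w s| ≤ η := by
  have h2 := (hasDerivWithinAt_iff_isLittleO.1 h).def hη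
  have h3 : Icc α β ∈ nhdsWithin β (Iio β) :=
    Icc_mem_nhdsLT (hr.1.trans hr.2)
  have h4 := (nhdsWithin_le_iff.2 h3) h2
  obtain ⟨t, ht, htr⟩ := (Filter.Eventually.and h4 (Ioo_mem_nhdsLT hr.2)).exists
  have hc : ContinuousOn w (Icc t β) := by
    intro x hx
    rcases hx.2.eq_or_lt with rfl | h5
    · exact h.continuousWithinAt.mono (Icc_subset_Icc (by linarith [htr.1, hr.1]) le_rfl)
    · exact (hd x ⟨by linarith [hx.1, htr.1, hr.1], h5⟩).continuousAt.continuousWithinAt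
  obtain ⟨s, hs, hse⟩ := exists_deriv_eq_slope w htr.2 hc fun x hx =>
    (hd x ⟨by linarith [hx.1, htr.1, hr.1], hx.2⟩).differentiableWithinAt
  refine ⟨s, ⟨htr.1.trans hs.1, hs.2⟩, ?_⟩
  have hpos : 0 < β - t := by linarith [htr.2]
  rw [hse, abs_div, abs_of_pos hpos, div_le_iff₀ hpos, abs_sub_comm]
  have h5 : |t - β| = β - t := by rw [abs_sub_comm, abs_of_pos hpos]
  simpa [h5] using ht

theorem SolvesRadialNeumann.continuousOn {N : ℕ} {α β : ℝ} {f w : ℝ → ℝ}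
    (h : SolvesRadialNeumann N α β f w) : ContinuousOn w (Icc α β) := by
  intro x hx
  rcases hx.1.eq_or_lt with rfl | h1
  · exact h.neumann_left.continuousWithinAt
  rcases hx.2.eq_or_lt with rfl | h2
  · exact h.neumann_right.continuousWithinAt
  exact (h.differentiableAt x ⟨h1, h2⟩).continuousAt.continuousWithinAt

/-- The bounds are asymmetric because the weight r^m can degenerate at α = 0 but never at β. -/
theorem continuousOn_Icc_of_abs_le {z : ℝ → ℝ} {α β C : ℝ} {m : ℕ} (hα : 0 ≤ α) (hαβ : α < β)
    (hz : ∀ r ∈ Ioo α β, ContinuousAt z r) (hzα : z α = 0) (hzβ : z β = 0)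
    (hl : ∀ r ∈ Ioo α β, |z r| ≤ C * (r - α))
    (hr : ∀ r ∈ Ioo α β, |r ^ m * z r| ≤ C * (β - r)) : ContinuousOn z (Icc α β) := by
  intro x hx
  rcases hx.1.eq_or_lt with rfl | h1
  · rw [ContinuousWithinAt, hzα]
    have h0 : Filter.Tendsto (fun r => C * (r - α)) (nhdsWithin α (Icc α β)) (nhds 0) := by
      have : Continuous fun r => C * (r - α) := by fun_prop
      simpa using (this.tendsto α).mono_left nhdsWithin_le_nhds
    refine squeeze_zero_norm' ?_ h0
    have h3 : Iio β ∈ nhdsWithin α (Icc α β) := mem_nhdsWithin_of_mem_nhds (Iio_mem_nhds hαβ)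
    filter_upwards [self_mem_nhdsWithin, h3] with r hr1 hr2
    rcases hr1.1.eq_or_lt with rfl | h5
    · simp [hzα]
    · exact hl r ⟨h5, hr2⟩
  rcases hx.2.eq_or_lt with rfl | h2
  · have hx0 : 0 < x := by linarith
    rw [ContinuousWithinAt, hzβ]
    have h0 : Filter.Tendsto (fun r => C * (x - r) / r ^ m) (nhdsWithin x (Icc α x))
        (nhds 0) := by
      have : ContinuousAt (fun r => C * (x - r) / r ^ m) x := by
        apply ContinuousAt.div (by fun_prop) (by fun_prop) (by positivity)
      have h4 := this.tendsto.mono_left (nhdsWithin_le_nhds (s := Icc α x))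
      simpa using h4
    refine squeeze_zero_norm' ?_ h0
    have h3 : Ioi α ∈ nhdsWithin x (Icc α x) := mem_nhdsWithin_of_mem_nhds (Ioi_mem_nhds hαβ)
    filter_upwards [self_mem_nhdsWithin, h3] with r hr1 hr2
    have hr2 : α < r := hr2
    have hr0 : 0 < r := by linarith
    rcases hr1.2.eq_or_lt with rfl | h5
    · simp [hzβ]
    · have := hr r ⟨hr2, h5⟩
      rw [abs_mul, abs_of_pos (by positivity : 0 < r ^ m)] at this
      rw [Real.norm_eq_abs, le_div_iff₀ (by positivity)]
      linarith
  exact (hz x ⟨h1, h2⟩).continuousWithinAt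

-- A vanishing one-sided derivative at an endpoint does not by itself make w' continuous there. The
-- equation bounds the derivative of the flux, and the mean value theorem provides points near the
-- endpoint where w' is small.
open Classical in
theorem SolvesRadialNeumann.exists_flow {N : ℕ} {α β : ℝ} {f w : ℝ → ℝ} (hα : 0 ≤ α)
    (hαβ : α < β) (hβ : β ≤ 1) (hf : ContinuousOn f (Icc α β))
    (h : SolvesRadialNeumann N α β f w) : ∃ z, Flow (N - 1) α β f w z := by
  set n := N - 1
  have hw := h.continuousOn
  obtain ⟨C, hC⟩ := isCompact_Icc.exists_bound_of_continuousOn (hw.sub hf)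
  have hC0 : 0 ≤ C := (norm_nonneg _).trans (hC α ⟨le_rfl, hαβ.le⟩)
  have hF : ∀ r ∈ Ioo α β, HasDerivAt (fun s => s ^ n * deriv w s) (r ^ n * (w r - f r)) r := by
    intro r hr
    have h1 := (h.differentiableAt_flux r hr).hasDerivAt
    have h2 := h.equation r hr
    refine h1.congr_deriv ?_
    change _ = r ^ (N - 1) * (w r - f r)
    linarith
  have hbd : ∀ r ∈ Ioo α β, |r ^ n * (w r - f r)| ≤ C * r ^ n := by
    intro r hr
    have h0 : 0 ≤ r ^ n := pow_nonneg (hα.trans hr.1.le) n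
    rw [abs_mul, abs_of_nonneg h0, mul_comm]
    exact mul_le_mul_of_nonneg_right (hC r (Ioo_subset_Icc_self hr)) h0
  have hFc : ∀ s t, α < s → t < β → ContinuousOn (fun s => s ^ n * deriv w s) (Icc s t) :=
    fun s t hs ht x hx =>
      (hF x ⟨hs.trans_le hx.1, hx.2.trans_lt ht⟩).continuousAt.continuousWithinAt
  have hsmall : ∀ s ∈ Ioo α β, ∀ η, |deriv w s| ≤ η → |s ^ n * deriv w s| ≤ η := by
    intro s hs η hη
    have h0 : 0 ≤ s ^ n := pow_nonneg (hα.trans hs.1.le) n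
    have h1 : s ^ n ≤ 1 := pow_le_one₀ (hα.trans hs.1.le) (hs.2.le.trans hβ)
    rw [abs_mul, abs_of_nonneg h0]
    exact (mul_le_of_le_one_left (abs_nonneg _) h1).trans hη
  -- The factor r^n survives on the right because x^n ≤ r^n for x ≤ r; dividing by it bounds w' by
  -- C(r - α) even when α = 0.
  have hleft : ∀ r ∈ Ioo α β, |r ^ n * deriv w r| ≤ C * r ^ n * (r - α) := by
    intro r hr
    have hr0 : 0 < r := hα.trans_lt hr.1
    refine le_of_forall_pos_le_add fun η hη => ?_
    obtain ⟨s, hs, hsη⟩ := exists_abs_deriv_le_left h.differentiableAt h.neumann_left hr hη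
    have h1 := abs_sub_le_mul_sub_of_abs_hasDerivAt_le hs.2.le (hFc s r hs.1 hr.2)
      (fun x hx => hF x ⟨hs.1.trans hx.1, hx.2.trans hr.2⟩) (C := C * r ^ n) fun x hx =>
        (hbd x ⟨hs.1.trans hx.1, hx.2.trans hr.2⟩).trans
          (mul_le_mul_of_nonneg_left
            (pow_le_pow_left₀ (by linarith [hs.1, hx.1]) hx.2.le n) hC0)
    have h2 := hsmall s ⟨hs.1, hs.2.trans hr.2⟩ η hsη
    have h3 : C * r ^ n * (r - s) ≤ C * r ^ n * (r - α) :=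
      mul_le_mul_of_nonneg_left (by linarith [hs.1]) (by positivity)
    have h4 := abs_sub_abs_le_abs_sub (r ^ n * deriv w r) (s ^ n * deriv w s)
    linarith
  have hright : ∀ r ∈ Ioo α β, |r ^ n * deriv w r| ≤ C * (β - r) := by
    intro r hr
    refine le_of_forall_pos_le_add fun η hη => ?_
    obtain ⟨s, hs, hsη⟩ := exists_abs_deriv_le_right h.differentiableAt h.neumann_right hr hη
    have h1 := abs_sub_le_mul_sub_of_abs_hasDerivAt_le hs.1.le (hFc r s hr.1 hs.2)
      (fun x hx => hF x ⟨hr.1.trans hx.1, hx.2.trans hs.2⟩) (C := C) fun x hx =>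
        (hbd x ⟨hr.1.trans hx.1, hx.2.trans hs.2⟩).trans
          (mul_le_of_le_one_right hC0 (pow_le_one₀ (by linarith [hr.1, hx.1])
            (by linarith [hs.2, hx.2])))
    have h2 := hsmall s ⟨hr.1.trans hs.1, hs.2⟩ η hsη
    have h3 : C * (s - r) ≤ C * (β - r) :=
      mul_le_mul_of_nonneg_left (by linarith [hs.2]) hC0
    have h4 := abs_sub_abs_le_abs_sub (r ^ n * deriv w r) (s ^ n * deriv w s)
    rw [abs_sub_comm] at h4
    linarith
  -- `deriv w` at an endpoint depends on w outside [α, β], so the value 0 is prescribed there.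
  let z : ℝ → ℝ := fun r => if r ∈ Ioo α β then deriv w r else 0
  have hzr : ∀ r ∈ Ioo α β, z r = deriv w r := fun r hr => if_pos hr
  have hzd : ∀ r ∈ Ioo α β, HasDerivAt z (w r - f r - n / r * z r) r := by
    intro r hr
    have hr0 : 0 < r := hα.trans_lt hr.1
    have h1 := (hF r hr).div (hasDerivAt_pow n r) (by positivity)
    have h2 : z =ᶠ[nhds r] fun s => s ^ n * deriv w s / s ^ n := by
      filter_upwards [isOpen_Ioo.mem_nhds hr] with s hs
      have hs0 : 0 < s := hα.trans_lt hs.1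
      rw [hzr s hs]
      field_simp
    refine (h1.congr_of_eventuallyEq h2).congr_deriv ?_
    rw [hzr r hr]
    rcases Nat.eq_zero_or_pos n with h0 | h0
    · simp [h0]
    · obtain ⟨k, hk⟩ := Nat.exists_eq_succ_of_ne_zero h0.ne'
      rw [hk]
      simp only [Nat.succ_eq_add_one, Nat.add_sub_cancel]
      field_simp
      ring
  have hzα : z α = 0 := if_neg (by simp)
  have hzβ : z β = 0 := if_neg (by simp)
  refine ⟨z, hw, ?_, hzα, hzβ, fun r hr => ?_, hzd⟩
  · refine continuousOn_Icc_of_abs_le (C := C) (m := n) hα hαβ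
      (fun r hr => (hzd r hr).continuousAt) hzα hzβ (fun r hr => ?_) fun r hr => ?_
    · have hr0 : 0 < r ^ n := pow_pos (hα.trans_lt hr.1) n
      have h1 := hleft r hr
      rw [abs_mul, abs_of_pos hr0, ← hzr r hr] at h1
      refine le_of_mul_le_mul_left ?_ hr0
      linarith
    · rw [hzr r hr]
      exact hright r hr
  · rw [hzr r hr]
    exact (h.differentiableAt r hr).hasDerivAt

section Flow

variable {n : ℕ} {α β : ℝ} {f w z : ℝ → ℝ}

theorem Flow.hasDerivAt_flux (h : Flow n α β f w z) (hα : 0 ≤ α) {r : ℝ} (hr : r ∈ Ioo α β) :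
    HasDerivAt (fun s => s ^ n * z s) (r ^ n * (w r - f r)) r := by
  have hr0 : 0 < r := hα.trans_lt hr.1
  refine ((hasDerivAt_pow n r).mul (h.hasDeriv_deriv r hr)).congr_deriv ?_
  rcases Nat.eq_zero_or_pos n with h0 | h0
  · subst h0; simp
  · obtain ⟨k, rfl⟩ := Nat.exists_eq_succ_of_ne_zero h0.ne'
    simp only [Nat.succ_eq_add_one, Nat.add_sub_cancel]
    field_simp
    ring

theorem Flow.continuousOn_flux (h : Flow n α β f w z) :
    ContinuousOn (fun s => s ^ n * z s) (Icc α β) :=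
  (continuousOn_pow n).mul h.cont_deriv

end Flow

section Flow

variable {n : ℕ} {α β : ℝ} {f w z : ℝ → ℝ}

theorem Flow.deriv_nonneg (h : Flow n α β f w z) (hm : MonotoneOn w (Icc α β)) {r : ℝ}
    (hr : r ∈ Icc α β) : 0 ≤ z r := by
  rcases hr.1.eq_or_lt with rfl | h1
  · exact h.left.ge
  rcases hr.2.eq_or_lt with rfl | h2
  · exact h.right.ge
  have h3 := hm.derivWithin_nonneg (x := r)
  rwa [derivWithin_of_mem_nhds (Icc_mem_nhds h1 h2), (h.hasDeriv r ⟨h1, h2⟩).deriv] at h3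

/-- On an interval where the derivative vanishes, the solution is a constant equal to the
right-hand side. -/
theorem Flow.eq_of_deriv_eq_zero (h : Flow n α β f w z) {a b : ℝ} (ha : α ≤ a)
    (hb : b ≤ β) (hz : ∀ r ∈ Ioo a b, z r = 0) :
    (∀ r ∈ Icc a b, w r = w a) ∧ ∀ r ∈ Ioo a b, w r = f r := by
  constructor
  · intro r hr
    have hc : ContinuousOn w (Icc a r) := h.cont.mono (Icc_subset_Icc ha (hr.2.trans hb))
    have h1 := abs_sub_le_mul_sub_of_abs_hasDerivAt_le (C := 0) hr.1 hc
      (fun x hx => h.hasDeriv x ⟨ha.trans_lt hx.1, hx.2.trans_le (hr.2.trans hb)⟩)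
      (fun x hx => by rw [hz x ⟨hx.1, hx.2.trans_le hr.2⟩, abs_zero])
    rw [zero_mul] at h1
    exact sub_eq_zero.1 (abs_nonpos_iff.1 h1)
  · intro r hr
    have h1 := h.hasDeriv_deriv r ⟨ha.trans_lt hr.1, hr.2.trans_le hb⟩
    have h2 : z =ᶠ[nhds r] fun _ => 0 := by
      filter_upwards [isOpen_Ioo.mem_nhds hr] with s hs using hz s hs
    have h3 := h1.unique ((hasDerivAt_const r (0 : ℝ)).congr_of_eventuallyEq h2)
    rw [hz r hr] at h3
    linarith

end Flow

/-! ### Crossing the value 1 -/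

theorem rpow_le_self_of_le_one {x p : ℝ} (hx : 0 ≤ x) (hx1 : x ≤ 1) (hp : 1 ≤ p) : x ^ p ≤ x := by
  rcases hx.eq_or_lt with rfl | h0
  · rw [Real.zero_rpow (by linarith)]
  · simpa using Real.rpow_le_rpow_of_exponent_ge h0 hx1 hp

theorem self_le_rpow_of_one_le {x p : ℝ} (hx : 1 ≤ x) (hp : 1 ≤ p) : x ≤ x ^ p := by
  simpa using Real.rpow_le_rpow_of_exponent_le hx hp

theorem eq_zero_or_eq_one_of_eq_rpow {x p : ℝ} (hx : 0 ≤ x) (hp : 1 < p) (h : x = x ^ p) :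
    x = 0 ∨ x = 1 := by
  rcases hx.eq_or_lt with h0 | h0
  · exact Or.inl h0.symm
  right
  by_contra hne
  rcases lt_or_gt_of_ne hne with h1 | h1
  · have := Real.rpow_lt_rpow_of_exponent_gt h0 h1 hp
    rw [Real.rpow_one] at this; linarith
  · have := Real.rpow_lt_rpow_of_exponent_lt h1 hp
    rw [Real.rpow_one] at this; linarith

/-- A nondecreasing solution is identically `0`, identically `1`, or crosses the value `1`. -/
theorem Flow.crosses_one {n : ℕ} {α β p : ℝ} {u z : ℝ → ℝ} (hα : 0 ≤ α) (hαβ : α < β)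
    (hp : 1 < p) (h : Flow n α β (fun r => u r ^ p) u z) (h0 : ∀ r ∈ Icc α β, 0 ≤ u r)
    (hm : MonotoneOn u (Icc α β)) (hne0 : ∃ r ∈ Icc α β, u r ≠ 0)
    (hne1 : ∃ r ∈ Icc α β, u r ≠ 1) : u α < 1 ∧ 1 < u β := by
  have hαm : α ∈ Icc α β := ⟨le_rfl, hαβ.le⟩
  have hβm : β ∈ Icc α β := ⟨hαβ.le, le_rfl⟩
  have key : ¬ ∀ r ∈ Ioo α β, z r = 0 := by
    intro hz
    obtain ⟨h1, h2⟩ := h.eq_of_deriv_eq_zero le_rfl le_rfl hz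
    have hmid : (α + β) / 2 ∈ Ioo α β := ⟨by linarith, by linarith⟩
    have h3 := h2 _ hmid
    simp only [h1 _ (Ioo_subset_Icc_self hmid)] at h3
    rcases eq_zero_or_eq_one_of_eq_rpow (h0 α hαm) hp h3 with h4 | h4
    · obtain ⟨r, hr, hr0⟩ := hne0
      exact hr0 ((h1 r hr).trans h4)
    · obtain ⟨r, hr, hr0⟩ := hne1
      exact hr0 ((h1 r hr).trans h4)
  have hpos : ∀ r ∈ Ioo α β, 0 < r ^ n := fun r hr => pow_pos (hα.trans_lt hr.1) n
  have hFα : α ^ n * z α = 0 := by rw [h.left, mul_zero]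
  have hFβ : β ^ n * z β = 0 := by rw [h.right, mul_zero]
  constructor
  -- If u ≥ 1 everywhere, the flux is nonincreasing from 0, yet nonnegative by monotonicity of u; so
  -- it vanishes, against `key`. The case u ≤ 1 is symmetric.
  · by_contra! hc
    refine key fun r hr => ?_
    have h1 : r ^ n * z r ≤ α ^ n * z α := le_of_hasDerivAt_nonpos hr.1.le
      (h.continuousOn_flux.mono (Icc_subset_Icc le_rfl hr.2.le))
      (fun x hx => h.hasDerivAt_flux hα ⟨hx.1, hx.2.trans hr.2⟩) fun x hx => by
        have hx' : x ∈ Ioo α β := ⟨hx.1, hx.2.trans hr.2⟩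
        have := hc.trans (hm hαm (Ioo_subset_Icc_self hx') hx.1.le)
        exact mul_nonpos_of_nonneg_of_nonpos (hpos x hx').le
          (by linarith [self_le_rpow_of_one_le this hp.le])
    have h2 := h.deriv_nonneg hm (Ioo_subset_Icc_self hr)
    rw [hFα] at h1
    have := hpos r hr
    nlinarith
  · by_contra! hc
    refine key fun r hr => ?_
    have h1 : r ^ n * z r ≤ β ^ n * z β := le_of_hasDerivAt_nonneg hr.2.le
      (h.continuousOn_flux.mono (Icc_subset_Icc hr.1.le le_rfl))
      (fun x hx => h.hasDerivAt_flux hα ⟨hr.1.trans hx.1, hx.2⟩) fun x hx => by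
        have hx' : x ∈ Ioo α β := ⟨hr.1.trans hx.1, hx.2⟩
        have := (hm (Ioo_subset_Icc_self hx') hβm hx.2.le).trans hc
        exact mul_nonneg (hpos x hx').le
          (by linarith [rpow_le_self_of_le_one (h0 x (Ioo_subset_Icc_self hx')) this hp.le])
    have h2 := h.deriv_nonneg hm (Ioo_subset_Icc_self hr)
    rw [hFβ] at h1
    have := hpos r hr
    nlinarith

/-! ### Energy, flux and position of the layer -/

/-- A nondecreasing solution of `-(r^n u')' + r^n u = r^n u^p` that crosses the value `1`. -/
structure LayerSolution (n : ℕ) (α β p : ℝ) (u z : ℝ → ℝ) : Prop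
    extends Flow n α β (fun r => u r ^ p) u z where
  left_nonneg : 0 ≤ α
  left_lt_right : α < β
  right_le_one : β ≤ 1
  two_le : 2 ≤ p
  nonneg : ∀ r ∈ Icc α β, 0 ≤ u r
  mono : MonotoneOn u (Icc α β)
  lt_one : u α < 1
  one_lt : 1 < u β

namespace LayerSolution

variable {n : ℕ} {α β p : ℝ} {u z : ℝ → ℝ}

theorem left_mem (h : LayerSolution n α β p u z) : α ∈ Icc α β := ⟨le_rfl, h.left_lt_right.le⟩

theorem right_mem (h : LayerSolution n α β p u z) : β ∈ Icc α β := ⟨h.left_lt_right.le, le_rfl⟩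

theorem z_nonneg (h : LayerSolution n α β p u z) {r : ℝ} (hr : r ∈ Icc α β) : 0 ≤ z r :=
  h.deriv_nonneg h.mono hr

theorem le_right (h : LayerSolution n α β p u z) {r : ℝ} (hr : r ∈ Icc α β) : u r ≤ u β :=
  h.mono hr h.right_mem hr.2

theorem pow_pos (h : LayerSolution n α β p u z) {r : ℝ} (hr : α < r) : 0 < r ^ n :=
  _root_.pow_pos (h.left_nonneg.trans_lt hr) n

theorem pow_le_one (h : LayerSolution n α β p u z) {r : ℝ} (hr : r ∈ Icc α β) : r ^ n ≤ 1 :=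
  pow_le_one₀ (h.left_nonneg.trans hr.1) (hr.2.trans h.right_le_one)

theorem flux_le_z (h : LayerSolution n α β p u z) {r : ℝ} (hr : r ∈ Icc α β) :
    r ^ n * z r ≤ z r :=
  mul_le_of_le_one_left (h.z_nonneg hr) (h.pow_le_one hr)

theorem hasDerivAt_energy (h : LayerSolution n α β p u z) {r : ℝ} (hr : r ∈ Ioo α β) :
    HasDerivAt (fun s => z s ^ 2 / 2 + u s ^ (p + 1) / (p + 1) - u s ^ 2 / 2)
      (-(n / r * z r ^ 2)) r := by
  have hp := h.two_le
  have h1 := h.hasDeriv r hr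
  have h2 := h.hasDeriv_deriv r hr
  have h3 := (((h2.pow 2).div_const 2).add
    ((h1.rpow_const (p := p + 1) (Or.inr (by linarith))).div_const (p + 1))).sub
      ((h1.pow 2).div_const 2)
  refine h3.congr_deriv ?_
  have hp1 : p + 1 ≠ 0 := by linarith
  rw [show p + 1 - 1 = p by ring]
  field_simp
  push_cast
  ring

theorem continuousOn_energy (h : LayerSolution n α β p u z) :
    ContinuousOn (fun s => z s ^ 2 / 2 + u s ^ (p + 1) / (p + 1) - u s ^ 2 / 2) (Icc α β) := by
  have hp := h.two_le
  exact (((h.cont_deriv.pow 2).div_const 2).add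
    ((h.cont.rpow_const fun x _ => Or.inr (by linarith)).div_const _)).sub
      ((h.cont.pow 2).div_const 2)

/-- The friction term n/r · z² dissipates energy, and at α the energy is nonpositive because z = 0
and 0 ≤ u < 1 there. -/
theorem energy_nonpos (h : LayerSolution n α β p u z) {r : ℝ} (hr : r ∈ Icc α β) :
    z r ^ 2 / 2 + u r ^ (p + 1) / (p + 1) - u r ^ 2 / 2 ≤ 0 := by
  have hp := h.two_le
  have h1 := le_of_hasDerivAt_nonpos hr.1
    (h.continuousOn_energy.mono (Icc_subset_Icc le_rfl hr.2))
    (fun x hx => h.hasDerivAt_energy ⟨hx.1, hx.2.trans_le hr.2⟩) fun x hx => by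
      have : 0 < x := h.left_nonneg.trans_lt hx.1
      have : 0 ≤ n / x * z x ^ 2 := by positivity
      linarith
  refine h1.trans ?_
  have h0 := h.nonneg α h.left_mem
  have h2 : u α ^ (p + 1) ≤ u α ^ 2 := by
    rcases h0.eq_or_lt with h3 | h3
    · rw [← h3, Real.zero_rpow (by linarith)]; norm_num
    · have := Real.rpow_le_rpow_of_exponent_ge h3 h.lt_one.le (by linarith : (2 : ℝ) ≤ p + 1)
      exact_mod_cast this
  have h3 : u α ^ (p + 1) / (p + 1) ≤ u α ^ (p + 1) / 2 :=
    div_le_div_of_nonneg_left (Real.rpow_nonneg h0 _) (by norm_num) (by linarith)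
  rw [h.left]
  linarith

theorem z_le (h : LayerSolution n α β p u z) {r : ℝ} (hr : r ∈ Icc α β) : z r ≤ u r := by
  have h1 := h.energy_nonpos hr
  have h0 := h.nonneg r hr
  have hp := h.two_le
  have h2 : 0 ≤ u r ^ (p + 1) / (p + 1) := div_nonneg (Real.rpow_nonneg h0 _) (by linarith)
  exact abs_le_of_sq_le_sq' (by linarith) h0 |>.2

theorem rpow_le (h : LayerSolution n α β p u z) {r : ℝ} (hr : r ∈ Icc α β) :
    u r ^ (p - 1) ≤ (p + 1) / 2 := by
  have hp := h.two_le
  have h0 := h.nonneg r hr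
  rcases h0.eq_or_lt with h3 | h3
  · rw [← h3, Real.zero_rpow (by linarith)]; linarith
  have h1 := h.energy_nonpos hr
  have h2 : u r ^ (p + 1) = u r ^ (p - 1) * u r ^ 2 := by
    rw [← Real.rpow_natCast, ← Real.rpow_add h3]; congr 1; push_cast; ring
  rw [h2] at h1
  have h4 : u r ^ (p - 1) * u r ^ 2 / (p + 1) ≤ u r ^ 2 / 2 := by nlinarith [sq_nonneg (z r)]
  rw [div_le_iff₀ (by linarith)] at h4
  have h5 : 0 < u r ^ 2 := by positivity
  nlinarith

/-- If u(β) > 2, Bernoulli gives u(β)^(p-1) > 2^(p-1) ≥ p, which exceeds the energy bound (p+1)/2.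
-/
theorem right_le_two (h : LayerSolution n α β p u z) : u β ≤ 2 := by
  have hp := h.two_le
  have h1 := h.rpow_le h.right_mem
  by_contra! hc
  have h2 := one_add_mul_self_le_rpow_one_add (s := 1) (p := p - 1) (by norm_num) (by linarith)
  have h3 : (2 : ℝ) ^ (p - 1) < u β ^ (p - 1) :=
    Real.rpow_lt_rpow (by norm_num) hc (by linarith)
  norm_num at h2
  linarith

theorem le_two (h : LayerSolution n α β p u z) {r : ℝ} (hr : r ∈ Icc α β) : u r ≤ 2 :=
  (h.le_right hr).trans h.right_le_two

theorem exists_eq_one (h : LayerSolution n α β p u z) : ∃ S ∈ Ioo α β, u S = 1 := by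
  obtain ⟨S, hS, hS1⟩ := intermediate_value_Icc h.left_lt_right.le h.cont
    ⟨h.lt_one.le, h.one_lt.le⟩
  refine ⟨S, ⟨hS.1.lt_of_ne ?_, hS.2.lt_of_ne ?_⟩, hS1⟩
  · rintro rfl; exact h.lt_one.ne hS1
  · rintro rfl; exact h.one_lt.ne' hS1

variable {S : ℝ}

/-- Since z ≤ u, the function u e^{-r} is nonincreasing, whence u(r) ≥ e^{r-S} ≥ e^{-1}. -/
theorem exp_le (h : LayerSolution n α β p u z) (hS : S ∈ Icc α β) (hS1 : u S = 1) {r : ℝ}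
    (hr : α ≤ r) (hrS : r ≤ S) : Real.exp (-1) ≤ u r := by
  have h1 : u S * Real.exp (-S) ≤ u r * Real.exp (-r) := by
    refine le_of_hasDerivAt_nonpos (f := fun s => u s * Real.exp (-s))
      (f' := fun s => (z s - u s) * Real.exp (-s)) hrS ?_ ?_ ?_
    · exact (h.cont.mono (Icc_subset_Icc hr hS.2)).mul (by fun_prop)
    · intro x hx
      have h2 := h.hasDeriv x ⟨hr.trans_lt hx.1, hx.2.trans_le hS.2⟩
      refine (h2.mul ((hasDerivAt_id x).neg.exp)).congr_deriv ?_
      simp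
      ring
    · intro x hx
      have := h.z_le (r := x) ⟨hr.trans hx.1.le, hx.2.le.trans hS.2⟩
      exact mul_nonpos_of_nonpos_of_nonneg (by linarith) (Real.exp_pos _).le
  rw [hS1, one_mul] at h1
  have h2 : u r * Real.exp (-r) ≤ u r * 1 :=
    mul_le_mul_of_nonneg_left (Real.exp_le_one_iff.2 (by linarith [h.left_nonneg]))
      (h.nonneg r ⟨hr, hrS.trans hS.2⟩)
  have h3 : Real.exp (-1) ≤ Real.exp (-S) :=
    Real.exp_le_exp.2 (by linarith [hS.2, h.right_le_one])
  linarith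

theorem flux_le_flux_left (h : LayerSolution n α β p u z) (hS : S ∈ Icc α β) (hS1 : u S = 1)
    {a b : ℝ} (ha : α ≤ a) (hab : a ≤ b) (hb : b ≤ S) : a ^ n * z a ≤ b ^ n * z b :=
  le_of_hasDerivAt_nonneg hab
    (h.continuousOn_flux.mono (Icc_subset_Icc ha (hb.trans hS.2)))
    (fun x hx => h.hasDerivAt_flux h.left_nonneg
      ⟨ha.trans_lt hx.1, hx.2.trans_le (hb.trans hS.2)⟩) fun x hx => by
      have hx' : x ∈ Icc α β := ⟨ha.trans hx.1.le, hx.2.le.trans (hb.trans hS.2)⟩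
      have h1 : u x ≤ 1 := hS1 ▸ h.mono hx' hS (hx.2.le.trans hb)
      exact mul_nonneg (h.pow_pos (ha.trans_lt hx.1)).le
        (by linarith [rpow_le_self_of_le_one (p := p) (h.nonneg x hx') h1 (by linarith [h.two_le])])

theorem flux_le_flux_right (h : LayerSolution n α β p u z) (hS : S ∈ Icc α β) (hS1 : u S = 1)
    {a b : ℝ} (ha : S ≤ a) (hab : a ≤ b) (hb : b ≤ β) : b ^ n * z b ≤ a ^ n * z a :=
  le_of_hasDerivAt_nonpos hab
    (h.continuousOn_flux.mono (Icc_subset_Icc (hS.1.trans ha) hb))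
    (fun x hx => h.hasDerivAt_flux h.left_nonneg
      ⟨(hS.1.trans ha).trans_lt hx.1, hx.2.trans_le hb⟩) fun x hx => by
      have hx' : x ∈ Icc α β := ⟨(hS.1.trans ha).trans hx.1.le, hx.2.le.trans hb⟩
      have h1 : 1 ≤ u x := hS1 ▸ h.mono hS hx' (ha.trans hx.1.le)
      exact mul_nonpos_of_nonneg_of_nonpos (h.pow_pos ((hS.1.trans ha).trans_lt hx.1)).le
        (by linarith [self_le_rpow_of_one_le (p := p) h1 (by linarith [h.two_le])])

/-- A zero of the flux would spread, by its monotonicity on each side of S, to the endpoint on the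
same side. There u would be constantly 0 or 1, against e^{-1} ≤ u(α) < 1 and u(β) > 1. -/
theorem flux_pos (h : LayerSolution n α β p u z) {m : ℝ} (hm : m ∈ Ioo α β) :
    0 < m ^ n * z m := by
  obtain ⟨S, hS, hS1⟩ := h.exists_eq_one
  have hS' := Ioo_subset_Icc_self hS
  have hm' := Ioo_subset_Icc_self hm
  have hp := h.two_le
  refine (mul_nonneg (h.pow_pos hm.1).le (h.z_nonneg hm')).lt_of_ne fun h0 => ?_
  rcases le_total m S with hmS | hmS
  · obtain ⟨h1, h2⟩ := h.eq_of_deriv_eq_zero le_rfl hm.2.le fun r hr => by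
      have hr' : r ∈ Icc α β := ⟨hr.1.le, hr.2.le.trans hm.2.le⟩
      have h3 := h.flux_le_flux_left hS' hS1 hr.1.le hr.2.le hmS
      have h4 := h.pow_pos hr.1
      have h5 := h.z_nonneg hr'
      rw [← h0] at h3
      nlinarith
    have hmid : (α + m) / 2 ∈ Ioo α m := ⟨by linarith [hm.1], by linarith [hm.1]⟩
    have h3 := h2 _ hmid
    simp only [h1 _ (Ioo_subset_Icc_self hmid)] at h3
    have h4 := h.exp_le hS' hS1 le_rfl hS.1.le
    have h5 := Real.exp_pos (-1)
    rcases eq_zero_or_eq_one_of_eq_rpow (h.nonneg α h.left_mem) (by linarith) h3 with h6 | h6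
    · linarith
    · linarith [h.lt_one]
  · obtain ⟨h1, h2⟩ := h.eq_of_deriv_eq_zero hm.1.le le_rfl fun r hr => by
      have hr' : r ∈ Icc α β := ⟨hm.1.le.trans hr.1.le, hr.2.le⟩
      have h3 := h.flux_le_flux_right hS' hS1 hmS hr.1.le hr.2.le
      have h4 := h.pow_pos (hm.1.trans hr.1)
      have h5 := h.z_nonneg hr'
      rw [← h0] at h3
      nlinarith
    have hmid : (m + β) / 2 ∈ Ioo m β := ⟨by linarith [hm.2], by linarith [hm.2]⟩
    have h3 := h2 _ hmid
    simp only [h1 _ (Ioo_subset_Icc_self hmid)] at h3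
    have h4 := h1 β ⟨hm.2.le, le_rfl⟩
    rw [← h4] at h3
    rcases eq_zero_or_eq_one_of_eq_rpow (h.nonneg β h.right_mem) (by linarith) h3 with h6 | h6
      <;> linarith [h.one_lt]

/-- The point where the solution takes the value `1` approaches the right endpoint. -/
theorem sub_sq_le (h : LayerSolution n α β p u z) (hS : S ∈ Ioo α β) (hS1 : u S = 1) :
    (p - 1) * (β - S) ^ 2 ≤ 4 := by
  have hp := h.two_le
  -- With F the flux at the midpoint m: z ≥ z(m) on [S, m] gives m^n (u(m) - 1) ≥ F(m - S), while
  -- Bernoulli on [m, β] gives F ≥ m^n (p-1)(u(m) - 1)(β - m). Combining and cancelling F > 0 yields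
  -- the claim.
  set m := (S + β) / 2 with hm
  have hSm : S < m := by linarith [hS.2]
  have hmβ : m < β := by linarith [hS.2]
  have hαm : α < m := hS.1.trans hSm
  have hm0 : 0 < m ^ n := h.pow_pos hαm
  have hmI : m ∈ Icc α β := ⟨hαm.le, hmβ.le⟩
  have hum : 1 ≤ u m := hS1 ▸ h.mono (Ioo_subset_Icc_self hS) hmI hSm.le
  have h1 : (m ^ n * z m) * (m - S) ≤ m ^ n * (u m - 1) := by
    have h2 : (z m) * (m - S) ≤ u m - u S := by
      refine mul_sub_le_sub_of_le_hasDerivAt hSm.le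
        (h.cont.mono (Icc_subset_Icc hS.1.le hmβ.le))
        (fun x hx => h.hasDeriv x ⟨hS.1.trans hx.1, hx.2.trans hmβ⟩) fun x hx => ?_
      have h3 := h.flux_le_flux_right (Ioo_subset_Icc_self hS) hS1 hx.1.le hx.2.le hmβ.le
      have hx0 : 0 < x ^ n := h.pow_pos (hS.1.trans hx.1)
      have h4 : x ^ n ≤ m ^ n :=
        pow_le_pow_left₀ (by linarith [h.left_nonneg, hS.1, hx.1]) hx.2.le n
      have h5 := h.z_nonneg (r := x) ⟨hS.1.le.trans hx.1.le, hx.2.le.trans hmβ.le⟩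
      have h6 : m ^ n * z m ≤ m ^ n * z x := h3.trans (mul_le_mul_of_nonneg_right h4 h5)
      exact le_of_mul_le_mul_left h6 hm0
    rw [hS1] at h2
    nlinarith
  have h2 : m ^ n * ((p - 1) * (u m - 1)) * (β - m) ≤ m ^ n * z m := by
    have h3 := sub_le_mul_sub_of_hasDerivAt_le (C := -(m ^ n * ((p - 1) * (u m - 1)))) hmβ.le
      (h.continuousOn_flux.mono (Icc_subset_Icc hαm.le le_rfl))
      (fun x hx => h.hasDerivAt_flux h.left_nonneg ⟨hαm.trans hx.1, hx.2⟩) fun x hx => by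
        have hxI : x ∈ Icc α β := ⟨hαm.le.trans hx.1.le, hx.2.le⟩
        have h4 : u m ≤ u x := h.mono hmI hxI hx.1.le
        have h5 := one_add_mul_self_le_rpow_one_add (s := u x - 1) (p := p)
          (by linarith) (by linarith)
        rw [add_sub_cancel] at h5
        have h6 : m ^ n ≤ x ^ n :=
          pow_le_pow_left₀ (by linarith [h.left_nonneg]) hx.1.le n
        have h7 : (p - 1) * (u m - 1) ≤ u x ^ p - u x := by nlinarith
        have h8 : 0 ≤ (p - 1) * (u m - 1) := mul_nonneg (by linarith) (by linarith)
        have h9 : m ^ n * ((p - 1) * (u m - 1)) ≤ x ^ n * (u x ^ p - u x) :=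
          mul_le_mul h6 h7 h8 (hm0.le.trans h6)
        linarith
    simp only [h.right, mul_zero] at h3
    linarith
  have hF := h.flux_pos (m := m) ⟨hαm, hmβ⟩
  have e1 : m - S = (β - S) / 2 := by rw [hm]; ring
  have e2 : β - m = (β - S) / 2 := by rw [hm]; ring
  rw [e1] at h1
  rw [e2] at h2
  have hL : 0 < β - S := by linarith [hS.2]
  have h3 : (p - 1) * ((β - S) / 2) * ((m ^ n * z m) * ((β - S) / 2)) ≤ m ^ n * z m := by
    refine le_trans (mul_le_mul_of_nonneg_left h1 (mul_nonneg (by linarith) (by linarith))) ?_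
    linarith
  have h4 : (p - 1) * (β - S) ^ 2 / 4 * (m ^ n * z m) ≤ 1 * (m ^ n * z m) := by linarith
  linarith [le_of_mul_le_mul_right h4 hF]

end LayerSolution

/-! ### Flux and height of the boundary layer -/

/-- Just below 1 the function x - x^p is steep: Bernoulli for (1/x)^(p-1) bounds x^(p-1) from above.
A slope 1/(4ε), independent of p, is enough. -/
theorem sub_div_le_sub_rpow {x p ε : ℝ} (hε : 0 < ε) (hε2 : ε ≤ 1 / 2) (hx : 1 - ε ≤ x)
    (hx1 : x ≤ 1) (hp : 2 ≤ p) (hpε : 1 ≤ (p - 1) * ε) :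
    (1 - x) / (4 * ε) ≤ x - x ^ p := by
  have hx0 : 0 < x := by linarith
  have h1 := one_add_mul_self_le_rpow_one_add (s := x⁻¹ - 1) (p := p - 1)
    (by have := inv_pos.2 hx0; linarith) (by linarith)
  rw [add_sub_cancel, Real.inv_rpow hx0.le] at h1
  have h2 : 0 < x ^ (p - 1) := Real.rpow_pos_of_pos hx0 _
  have h3 : x ^ (p - 1) * (x + (p - 1) * (1 - x)) ≤ x := by
    have h4 := mul_le_mul_of_nonneg_left h1 (mul_pos h2 hx0).le
    have h5 : x ^ (p - 1) * x * (x ^ (p - 1))⁻¹ = x := by field_simp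
    have h6 : x ^ (p - 1) * x * (1 + (p - 1) * (x⁻¹ - 1)) =
        x ^ (p - 1) * (x + (p - 1) * (1 - x)) := by field_simp
    linarith
  have h4 : x ^ p = x ^ (p - 1) * x := by
    rw [← Real.rpow_add_one hx0.ne']; congr 1; ring
  have hy0 : 0 ≤ 1 - x := by linarith
  set y := 1 - x with hy
  set P := x ^ (p - 1)
  have hden : x + (p - 1) * y ≤ 2 * ((p - 1) * ε) := by nlinarith
  have h7 : (p - 1) * y ≤ (1 - P) * (x + (p - 1) * y) := by nlinarith
  have hP1 : 0 ≤ 1 - P := by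
    have : P ≤ 1 := Real.rpow_le_one hx0.le hx1 (by linarith)
    linarith
  have h8 : (p - 1) * y ≤ (p - 1) * ((1 - P) * (2 * ε)) := by
    calc (p - 1) * y ≤ (1 - P) * (x + (p - 1) * y) := h7
      _ ≤ (1 - P) * (2 * ((p - 1) * ε)) := mul_le_mul_of_nonneg_left hden hP1
      _ = _ := by ring
  have h9 : y ≤ (1 - P) * (2 * ε) := le_of_mul_le_mul_left h8 (by linarith)
  rw [h4, div_le_iff₀ (by linarith)]
  have h10 : 1 / 2 ≤ x := by linarith
  have h11 : (1 - P) * (2 * ε) * (1 / 2) ≤ (1 - P) * (2 * ε) * x :=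
    mul_le_mul_of_nonneg_left h10 (by positivity)
  linarith

namespace LayerSolution

variable {n : ℕ} {α β p S : ℝ} {u z : ℝ → ℝ}

/-- At a fixed distance from the right endpoint the solution stays away from `1`. -/
theorem lt_one_sub (h : LayerSolution n α β p u z) (hS : S ∈ Ioo α β) (hS1 : u S = 1)
    {a m ε : ℝ} (ha : α < a) (ham : a < m) (hmS : m < S) (hε : 0 < ε) (hε2 : ε ≤ 1 / 2)
    (hpε : 1 ≤ (p - 1) * ε) (hc : 4 * ε < a ^ n * (m - a) * (S - m)) : u a < 1 - ε := by
  -- If u ≥ 1 - ε on [a, m], the flux F at m reproduces itself amplified: 1 - u(m) ≥ F(S - m), and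
  -- steepness gives F ≥ a^n (m - a)(1 - u(m))/(4ε), which exceeds F by `hc`.
  by_contra! hcon
  have hmβ : m < β := hmS.trans hS.2
  have hmI : m ∈ Icc α β := ⟨(ha.trans ham).le, hmβ.le⟩
  have haI : a ∈ Icc α β := ⟨ha.le, (ham.trans hmβ).le⟩
  have ha0 : 0 < a ^ n := h.pow_pos ha
  have hF := h.flux_pos (m := m) ⟨ha.trans ham, hmβ⟩
  have hum : u m ≤ 1 := hS1 ▸ h.mono hmI (Ioo_subset_Icc_self hS) hmS.le
  have h1 : (m ^ n * z m) * (S - m) ≤ 1 - u m := by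
    rw [← hS1]
    refine mul_sub_le_sub_of_le_hasDerivAt hmS.le
      (h.cont.mono (Icc_subset_Icc hmI.1 hS.2.le))
      (fun x hx => h.hasDeriv x ⟨hmI.1.trans_lt hx.1, hx.2.trans hS.2⟩) fun x hx => ?_
    exact (h.flux_le_flux_left (Ioo_subset_Icc_self hS) hS1 hmI.1 hx.1.le hx.2.le).trans
      (h.flux_le_z ⟨hmI.1.trans hx.1.le, hx.2.le.trans hS.2.le⟩)
  have h2 : a ^ n * ((1 - u m) / (4 * ε)) * (m - a) ≤ m ^ n * z m - a ^ n * z a := by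
    refine mul_sub_le_sub_of_le_hasDerivAt (f := fun s => s ^ n * z s) ham.le
      (h.continuousOn_flux.mono (Icc_subset_Icc ha.le hmβ.le))
      (fun x hx => h.hasDerivAt_flux h.left_nonneg ⟨ha.trans hx.1, hx.2.trans hmβ⟩)
      fun x hx => ?_
    have hxI : x ∈ Icc α β := ⟨ha.le.trans hx.1.le, hx.2.le.trans hmβ.le⟩
    have h3 : u x ≤ u m := h.mono hxI hmI hx.2.le
    have h4 := sub_div_le_sub_rpow hε hε2 (hcon.trans (h.mono haI hxI hx.1.le))
      (h3.trans hum) h.two_le hpε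
    have h5 : (1 - u m) / (4 * ε) ≤ (1 - u x) / (4 * ε) := by gcongr
    have h6 : 0 ≤ (1 - u m) / (4 * ε) := div_nonneg (by linarith) (by linarith)
    have h7 : a ^ n ≤ x ^ n := pow_le_pow_left₀ (h.left_nonneg.trans ha.le) hx.1.le n
    exact mul_le_mul h7 (h5.trans h4) h6 (ha0.le.trans h7)
  have h3 : 0 ≤ a ^ n * z a := mul_nonneg ha0.le (h.z_nonneg haI)
  have hma : 0 < m - a := by linarith
  have h4 : a ^ n * (((m ^ n * z m) * (S - m)) / (4 * ε)) * (m - a) ≤ m ^ n * z m := by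
    refine le_trans ?_ (h2.trans (by linarith))
    gcongr
  have h5 : a ^ n * (((m ^ n * z m) * (S - m)) / (4 * ε)) * (m - a) =
      (a ^ n * (m - a) * (S - m)) * (m ^ n * z m) / (4 * ε) := by ring
  rw [h5, div_le_iff₀ (by linarith), mul_comm (m ^ n * z m)] at h4
  linarith [le_of_mul_le_mul_right h4 hF]

/-- As p ≥ 2, u^(p-1) ≤ u < 1 - ε on (a, b), so u - u^p = u(1 - u^(p-1)) ≥ e^{-1} ε whatever p is.
-/
theorem le_flux (h : LayerSolution n α β p u z) (hS : S ∈ Ioo α β) (hS1 : u S = 1)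
    {a b ε : ℝ} (ha : α < a) (hab : a < b) (hbS : b < S) (hε : 0 < ε) (hb : u b < 1 - ε) :
    a ^ n * (Real.exp (-1) * ε) * (b - a) ≤ b ^ n * z b := by
  have hbβ : b < β := hbS.trans hS.2
  have ha0 : 0 < a ^ n := h.pow_pos ha
  have hp := h.two_le
  have h3 : 0 ≤ a ^ n * z a := mul_nonneg ha0.le (h.z_nonneg ⟨ha.le, (hab.trans hbβ).le⟩)
  refine le_trans ?_ (sub_le_self _ h3)
  refine mul_sub_le_sub_of_le_hasDerivAt (f := fun s => s ^ n * z s) hab.le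
    (h.continuousOn_flux.mono (Icc_subset_Icc ha.le hbβ.le))
    (fun x hx => h.hasDerivAt_flux h.left_nonneg ⟨ha.trans hx.1, hx.2.trans hbβ⟩)
    fun x hx => ?_
  have hxI : x ∈ Icc α β := ⟨ha.le.trans hx.1.le, hx.2.le.trans hbβ.le⟩
  have h7 : a ^ n ≤ x ^ n := pow_le_pow_left₀ (h.left_nonneg.trans ha.le) hx.1.le n
  have h4 := h.exp_le (Ioo_subset_Icc_self hS) hS1 hxI.1 (hx.2.trans hbS).le
  have hx0 : 0 < u x := (Real.exp_pos _).trans_le h4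
  have h5 : u x < 1 - ε :=
    (h.mono hxI ⟨(ha.trans hab).le, hbβ.le⟩ hx.2.le).trans_lt hb
  have h6 : u x ^ p = u x ^ (p - 1) * u x := by
    rw [← Real.rpow_add_one hx0.ne']; congr 1; ring
  have h8 := rpow_le_self_of_le_one (p := p - 1) hx0.le (by linarith) (by linarith)
  have h9 : Real.exp (-1) * ε ≤ u x - u x ^ p := by
    rw [h6]
    calc Real.exp (-1) * ε ≤ u x * (1 - u x ^ (p - 1)) :=
          mul_le_mul h4 (by linarith) hε.le hx0.le
      _ = _ := by ring
  exact mul_le_mul h7 h9 (mul_pos (Real.exp_pos _) hε).le (ha0.le.trans h7)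

/-- Lower bound for the height of the layer in terms of the incoming flux. -/
theorem le_rpow_right (h : LayerSolution n α β p u z) (hS : S ∈ Ioo α β) (hS1 : u S = 1)
    {a c : ℝ} (ha : 0 < a) (haS : a ≤ S) (hc : 0 ≤ c) (hcS : c ≤ S ^ n * z S)
    (hd : 4 * n / a * (β - S) ≤ c ^ 2 / 4) : c ^ 2 / 8 * p ≤ u β ^ p := by
  have hp := h.two_le
  have hSI := Ioo_subset_Icc_self hS
  -- The kinetic energy at S is at least c²/2 and z ≤ 2 limits dissipation on [S, β] to c²/4. Since
  -- z(β) = 0, the rest must sit in the term u^{p+1}/(p+1).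
  have h1 := mul_sub_le_sub_of_le_hasDerivAt (C := -(4 * n / a)) hS.2.le
    (h.continuousOn_energy.mono (Icc_subset_Icc hS.1.le le_rfl))
    (fun x hx => h.hasDerivAt_energy ⟨hS.1.trans hx.1, hx.2⟩) fun x hx => by
      have hxI : x ∈ Icc α β := ⟨hS.1.le.trans hx.1.le, hx.2.le⟩
      have h2 : z x ≤ 2 := (h.z_le hxI).trans (h.le_two hxI)
      have h3 := h.z_nonneg hxI
      have h4 : z x ^ 2 ≤ 4 := by nlinarith
      have h5 : (n : ℝ) / x ≤ n / a := by
        have := haS.trans hx.1.le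
        gcongr
      have h6 : 0 ≤ (n : ℝ) / a := by positivity
      have h7 : (n : ℝ) / x * z x ^ 2 ≤ n / a * 4 := mul_le_mul h5 h4 (sq_nonneg _) h6
      have h8 : 4 * (n : ℝ) / a = n / a * 4 := by ring
      linarith
  simp only [h.right, hS1, Real.one_rpow] at h1
  have h2 : c ≤ z S := hcS.trans (h.flux_le_z hSI)
  have h3 : c ^ 2 ≤ z S ^ 2 := pow_le_pow_left₀ hc h2 2
  have hβ0 := h.one_lt
  have h4 : 0 ≤ 1 / (p + 1) := by positivity
  have h5 : c ^ 2 / 4 ≤ u β ^ (p + 1) / (p + 1) := by nlinarith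
  rw [le_div_iff₀ (by linarith), Real.rpow_add_one (by linarith)] at h5
  have h6 : u β ^ p * u β ≤ u β ^ p * 2 :=
    mul_le_mul_of_nonneg_left h.right_le_two (Real.rpow_nonneg (by linarith) _)
  nlinarith [sq_nonneg c]

/-- Just inside the boundary layer the flux is still bounded below. -/
theorem le_flux_layer (h : LayerSolution n α β p u z) {a c κ : ℝ} (ha : 0 < a)
    (hκ : 0 < κ) (hκ2 : κ ≤ 1 / 2) (haT : a ≤ β - κ / p) (hαT : α ≤ β - κ / p) (hc : 0 ≤ c)
    (hM : c * p ≤ u β ^ p) (hcp : 8 ≤ c * p) :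
    a ^ n * (c / 4) * κ ≤ (β - κ / p) ^ n * z (β - κ / p) := by
  have hp := h.two_le
  have hp0 : 0 < p := by linarith
  set T := β - κ / p with hT
  have hTβ : β - T = κ / p := by rw [hT]; ring
  have hκp : 0 < κ / p := div_pos hκ hp0
  have hTI : T ∈ Icc α β := ⟨hαT, by linarith⟩
  -- From T to β, u changes at most by the factor 1 - κ/p, whose p-th power is at least 1 - κ ≥ 1/2.
  have h1 : u β * (1 - κ / p) ≤ u T := by
    have := sub_le_mul_sub_of_hasDerivAt_le (C := u β) hTI.2
      (h.cont.mono (Icc_subset_Icc hTI.1 le_rfl))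
      (fun x hx => h.hasDeriv x ⟨hTI.1.trans_lt hx.1, hx.2⟩) fun x hx => by
        have hxI : x ∈ Icc α β := ⟨hTI.1.trans hx.1.le, hx.2.le⟩
        exact (h.z_le hxI).trans (h.le_right hxI)
    rw [hTβ] at this
    linarith
  have hκ1 : κ / p ≤ 1 := by rw [div_le_one hp0]; linarith
  have hβ0 : 0 < u β := by linarith [h.one_lt]
  have h2 : u β ^ p / 2 ≤ u T ^ p := by
    have h3 := Real.rpow_le_rpow (mul_nonneg hβ0.le (by linarith)) h1 hp0.le
    rw [Real.mul_rpow hβ0.le (by linarith)] at h3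
    have h4 := one_add_mul_self_le_rpow_one_add (s := -(κ / p)) (p := p)
      (by linarith) (by linarith)
    have h5 : p * -(κ / p) = -κ := by field_simp
    rw [h5, ← sub_eq_add_neg, ← sub_eq_add_neg] at h4
    have h6 : u β ^ p * (1 / 2) ≤ u β ^ p * (1 - κ / p) ^ p :=
      mul_le_mul_of_nonneg_left (by linarith) (Real.rpow_nonneg hβ0.le _)
    linarith
  have h3 : c / 4 * p ≤ u T ^ p - u β := by
    have := h.right_le_two
    linarith
  have h4 := sub_le_mul_sub_of_hasDerivAt_le (C := -(a ^ n * (c / 4 * p))) hTI.2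
    (h.continuousOn_flux.mono (Icc_subset_Icc hTI.1 le_rfl))
    (fun x hx => h.hasDerivAt_flux h.left_nonneg ⟨hTI.1.trans_lt hx.1, hx.2⟩) fun x hx => by
      have hxI : x ∈ Icc α β := ⟨hTI.1.trans hx.1.le, hx.2.le⟩
      have h5 : u T ^ p ≤ u x ^ p :=
        Real.rpow_le_rpow (h.nonneg T hTI) (h.mono hTI hxI hx.1.le) hp0.le
      have h6 := h.le_right hxI
      have h7 : a ^ n ≤ x ^ n := pow_le_pow_left₀ ha.le (haT.trans hx.1.le) n
      have h8 : a ^ n * (c / 4 * p) ≤ x ^ n * (u x ^ p - u x) :=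
        mul_le_mul h7 (by linarith) (by positivity) ((pow_nonneg ha.le n).trans h7)
      linarith
  simp only [h.right, mul_zero, hTβ] at h4
  have h5 : a ^ n * (c / 4 * p) * (κ / p) = a ^ n * (c / 4) * κ := by field_simp
  linarith

end LayerSolution

/-! ### Bounds on kernel elements -/

namespace LayerSolution

variable {k : ℕ} {α β p V : ℝ} {u z v y : ℝ → ℝ}

/-- The weighted Wronskian of `z = u'` and `v`, with `z'` eliminated by the equation. -/
noncomputable def wronskian (k : ℕ) (p : ℝ) (u z v y : ℝ → ℝ) (r : ℝ) : ℝ :=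
  z r * (r ^ (k + 2) * y r) -
    v r * (r ^ (k + 2) * (u r - u r ^ p) - (k + 2) * (r ^ (k + 1) * z r))

theorem hasDerivAt_rpow (h : LayerSolution (k + 2) α β p u z) {r : ℝ} (hr : r ∈ Ioo α β) :
    HasDerivAt (fun s => u s ^ p) (p * u r ^ (p - 1) * z r) r :=
  ((h.hasDeriv r hr).rpow_const (p := p) (Or.inr (by linarith [h.two_le]))).congr_deriv
    (by ring)

theorem continuousOn_rpow (h : LayerSolution (k + 2) α β p u z) :
    ContinuousOn (fun s => u s ^ p) (Icc α β) :=
  h.cont.rpow_const fun _ _ => Or.inr (by linarith [h.two_le])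

/-- The only term that does not cancel comes from differentiating the coefficient n/r. With n = k +
2 its weight r^k stays bounded down to α = 0; this is where N ≥ 3 enters. -/
theorem hasDerivAt_wronskian (h : LayerSolution (k + 2) α β p u z)
    (g : Flow (k + 2) α β (fun r => p * u r ^ (p - 1) * v r) v y) {r : ℝ} (hr : r ∈ Ioo α β) :
    HasDerivAt (wronskian k p u z v y) (-((k + 2) * r ^ k * z r * v r)) r := by
  have hr0 : 0 < r := h.left_nonneg.trans_lt hr.1
  have h1 := ((h.hasDeriv_deriv r hr).mul (g.hasDerivAt_flux h.left_nonneg hr)).sub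
    ((g.hasDeriv r hr).mul
      (((hasDerivAt_pow (k + 2) r).mul ((h.hasDeriv r hr).sub (h.hasDerivAt_rpow hr))).sub
        (((hasDerivAt_pow (k + 1) r).mul (h.hasDeriv_deriv r hr)).const_mul ((k : ℝ) + 2))))
  refine h1.congr_deriv ?_
  simp only [Pi.mul_apply, Pi.sub_apply, Nat.cast_add, Nat.cast_one, Nat.cast_ofNat,
    Nat.add_sub_cancel, show k + 2 - 1 = k + 1 by omega]
  field_simp
  ring

theorem continuousOn_wronskian (h : LayerSolution (k + 2) α β p u z)
    (g : Flow (k + 2) α β (fun r => p * u r ^ (p - 1) * v r) v y) :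
    ContinuousOn (wronskian k p u z v y) (Icc α β) := by
  have h1 := h.cont
  have h2 := h.cont_deriv
  have h3 := g.cont
  have h4 := g.cont_deriv
  have h5 := h.continuousOn_rpow
  exact (h2.mul ((continuousOn_pow _).mul h4)).sub (h3.mul
    (((continuousOn_pow _).mul (h1.sub h5)).sub
      (continuousOn_const.mul ((continuousOn_pow _).mul h2))))

/-- Since |W'| ≤ (k+2) V u', the variation of W is at most (k+2) V times the increment of u, which
is at most 2; the value at α adds V. -/
theorem abs_wronskian_le (h : LayerSolution (k + 2) α β p u z)
    (g : Flow (k + 2) α β (fun r => p * u r ^ (p - 1) * v r) v y)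
    (hV : ∀ r ∈ Icc α β, |v r| ≤ V) {r : ℝ} (hr : r ∈ Icc α β) :
    |wronskian k p u z v y r| ≤ (2 * k + 5) * V := by
  have hp := h.two_le
  have hV0 : 0 ≤ V := (abs_nonneg _).trans (hV α h.left_mem)
  have hα := h.nonneg α h.left_mem
  have hleft : |wronskian k p u z v y α| ≤ V := by
    rw [wronskian, h.left, zero_mul, zero_sub, abs_neg, mul_zero, mul_zero, sub_zero, abs_mul]
    refine (mul_le_of_le_one_right (abs_nonneg _) ?_).trans (hV α h.left_mem)
    have h1 := rpow_le_self_of_le_one (p := p) hα h.lt_one.le (by linarith)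
    have h2 := Real.rpow_nonneg hα p
    have h3 := h.pow_le_one h.left_mem
    have h4 : 0 ≤ α ^ (k + 2) := pow_nonneg h.left_nonneg _
    rw [abs_mul, abs_of_nonneg h4, abs_of_nonneg (by linarith)]
    exact mul_le_one₀ h3 (by linarith) (by linarith [h.lt_one])
  have hbd : ∀ x ∈ Ioo α r, |(k + 2) * x ^ k * z x * v x| ≤ (k + 2) * V * z x := by
    intro x hx
    have hxI : x ∈ Icc α β := ⟨hx.1.le, hx.2.le.trans hr.2⟩
    have hz := h.z_nonneg hxI
    have hx0 : 0 ≤ x := h.left_nonneg.trans hx.1.le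
    have h1 : x ^ k ≤ 1 := pow_le_one₀ hx0 (hxI.2.trans h.right_le_one)
    have h2 : 0 ≤ ((k : ℝ) + 2) * x ^ k * z x := by positivity
    rw [abs_mul, abs_of_nonneg h2]
    calc ((k : ℝ) + 2) * x ^ k * z x * |v x| ≤ (k + 2) * 1 * z x * V := by
          gcongr
          exact hV x hxI
      _ = _ := by ring
  have hcW := (h.continuousOn_wronskian g).mono (Icc_subset_Icc le_rfl hr.2)
  have hcu := (h.cont.mono (Icc_subset_Icc (le_refl α) hr.2)).const_mul (((k : ℝ) + 2) * V)
  have hdW : ∀ x ∈ Ioo α r, HasDerivAt (wronskian k p u z v y)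
      (-((k + 2) * x ^ k * z x * v x)) x :=
    fun x hx => h.hasDerivAt_wronskian g ⟨hx.1, hx.2.trans_le hr.2⟩
  have hdu : ∀ x ∈ Ioo α r, HasDerivAt (fun s => ((k : ℝ) + 2) * V * u s)
      ((k + 2) * V * z x) x :=
    fun x hx => (h.hasDeriv x ⟨hx.1, hx.2.trans_le hr.2⟩).const_mul _
  have h1 := le_of_hasDerivAt_nonneg hr.1 (hcu.add hcW) (fun x hx => (hdu x hx).add (hdW x hx))
    fun x hx => by linarith [(abs_le.1 (hbd x hx)).2]
  have h2 := le_of_hasDerivAt_nonneg hr.1 (hcu.sub hcW) (fun x hx => (hdu x hx).sub (hdW x hx))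
    fun x hx => by linarith [(abs_le.1 (hbd x hx)).1]
  simp only [Pi.add_apply, Pi.sub_apply] at h1 h2
  have h3 : ((k : ℝ) + 2) * V * (u r - u α) ≤ (k + 2) * V * 2 :=
    mul_le_mul_of_nonneg_left (by linarith [h.le_two hr]) (by positivity)
  obtain ⟨h4, h5⟩ := abs_le.1 hleft
  rw [abs_le]
  constructor <;> linarith

/-- As z vanishes at β, the Wronskian there reduces to v times β^(k+2) (u^p - u). A high layer thus
forces v(β) to be small. -/
theorem abs_right_mul_le (h : LayerSolution (k + 2) α β p u z)
    (g : Flow (k + 2) α β (fun r => p * u r ^ (p - 1) * v r) v y)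
    (hV : ∀ r ∈ Icc α β, |v r| ≤ V) :
    |v β| * (β ^ (k + 2) * (u β ^ p - u β)) ≤ (2 * k + 5) * V := by
  have h1 := h.abs_wronskian_le g hV h.right_mem
  rw [wronskian, h.right, zero_mul, zero_sub, abs_neg, mul_zero, mul_zero, sub_zero, abs_mul,
    abs_mul] at h1
  have h2 : u β - u β ^ p ≤ 0 := by
    linarith [self_le_rpow_of_one_le (p := p) h.one_lt.le (by linarith [h.two_le])]
  rwa [abs_of_nonpos h2, abs_of_pos (h.pow_pos h.left_lt_right), neg_sub] at h1

/-- Left of the boundary layer, kernel elements grow in absolute value. -/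
theorem sq_le_sq_left (h : LayerSolution (k + 2) α β p u z)
    (g : Flow (k + 2) α β (fun r => p * u r ^ (p - 1) * v r) v y) {R : ℝ} (hR : R ∈ Icc α β)
    (hpR : p * u R ^ (p - 1) ≤ 1) {r : ℝ} (hr : α ≤ r) (hrR : r ≤ R) : v r ^ 2 ≤ v R ^ 2 := by
  have hp := h.two_le
  -- The product of v with its flux starts at 0 and has derivative s^(k+2) ((1 - p u^(p-1)) v² + y²)
  -- ≥ 0.
  have key : ∀ x ∈ Ioo α R, 0 ≤ (x ^ (k + 2) * y x) * v x := by
    intro x hx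
    have hxR : x ≤ β := hx.2.le.trans hR.2
    have h1 := le_of_hasDerivAt_nonneg hx.1.le
      ((g.continuousOn_flux.mul g.cont).mono (Icc_subset_Icc le_rfl hxR))
      (fun s hs => (g.hasDerivAt_flux h.left_nonneg ⟨hs.1, hs.2.trans_le hxR⟩).mul
        (g.hasDeriv s ⟨hs.1, hs.2.trans_le hxR⟩)) fun s hs => by
          have hsI : s ∈ Icc α β := ⟨hs.1.le, hs.2.le.trans hxR⟩
          have h2 : u s ^ (p - 1) ≤ u R ^ (p - 1) :=
            Real.rpow_le_rpow (h.nonneg s hsI) (h.mono hsI hR (hs.2.trans hx.2).le)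
              (by linarith)
          have h3 : 0 ≤ 1 - p * u s ^ (p - 1) := by nlinarith
          have h4 := h.pow_pos hs.1
          have h5 : 0 ≤ s ^ (k + 2) * ((1 - p * u s ^ (p - 1)) * v s ^ 2 + y s ^ 2) := by
            positivity
          linarith
    simp only [Pi.mul_apply, g.left] at h1
    linarith
  refine le_of_hasDerivAt_nonneg (f := fun s => v s ^ 2) hrR
    ((g.cont.mono (Icc_subset_Icc hr hR.2)).pow 2)
    (fun x hx => (g.hasDeriv x ⟨hr.trans_lt hx.1, hx.2.trans_le hR.2⟩).pow 2) fun x hx => ?_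
  have h1 := key x ⟨hr.trans_lt hx.1, hx.2⟩
  have h2 := h.pow_pos (hr.trans_lt hx.1)
  have h3 : 0 ≤ y x * v x := by
    rw [mul_assoc] at h1
    exact nonneg_of_mul_nonneg_right h1 h2
  simp only [Nat.cast_ofNat, Nat.add_one_sub_one, pow_one]
  linarith

/-- Inside the boundary layer, kernel elements are controlled by their boundary value. -/
theorem abs_le_two_mul_abs_right (h : LayerSolution (k + 2) α β p u z)
    (g : Flow (k + 2) α β (fun r => p * u r ^ (p - 1) * v r) v y) {T : ℝ} (hαT : α < T)
    (hTβ : T ≤ β) (hT : 4 * p ^ 2 * (β - T) ^ 2 ≤ T ^ (k + 2)) {r : ℝ} (hr : r ∈ Icc T β) :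
    |v r| ≤ 2 * |v β| := by
  have hp := h.two_le
  -- Integrating twice from β, where y = 0, bounds |v(β) - v| on [T, β] by half the maximum A of
  -- |v|, so A ≤ 2|v(β)|.
  obtain ⟨t, ht, htm⟩ := isCompact_Icc.exists_isMaxOn (nonempty_Icc.2 hTβ)
    (g.cont.mono (Icc_subset_Icc hαT.le le_rfl)).abs
  set A := |v t| with hA
  have hAr : ∀ s ∈ Icc T β, |v s| ≤ A := fun s hs => htm hs
  have hA0 : 0 ≤ A := abs_nonneg _
  have hT0 : 0 < T ^ (k + 2) := h.pow_pos hαT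
  have hG : ∀ s ∈ Ioo T β, |s ^ (k + 2) * y s| ≤ 2 * p ^ 2 * A * (β - T) := by
    intro s hs
    have h1 := abs_sub_le_mul_sub_of_abs_hasDerivAt_le (C := 2 * p ^ 2 * A) hs.2.le
      (g.continuousOn_flux.mono (Icc_subset_Icc (hαT.le.trans hs.1.le) le_rfl))
      (fun x hx => g.hasDerivAt_flux h.left_nonneg ⟨hαT.trans (hs.1.trans hx.1), hx.2⟩)
      fun x hx => by
        have hxI : x ∈ Icc α β := ⟨(hαT.trans (hs.1.trans hx.1)).le, hx.2.le⟩
        have h2 : |x ^ (k + 2)| ≤ 1 := by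
          rw [abs_of_pos (h.pow_pos (hαT.trans (hs.1.trans hx.1)))]
          exact h.pow_le_one hxI
        have h3 := h.rpow_le hxI
        have h4 := Real.rpow_nonneg (h.nonneg x hxI) (p - 1)
        have h5 : |1 - p * u x ^ (p - 1)| ≤ 2 * p ^ 2 := by
          have h6 : p * u x ^ (p - 1) ≤ p * ((p + 1) / 2) :=
            mul_le_mul_of_nonneg_left h3 (by linarith)
          have h7 : 0 ≤ p * u x ^ (p - 1) := by positivity
          rw [abs_le]
          constructor <;> nlinarith
        have h6 : v x - p * u x ^ (p - 1) * v x = (1 - p * u x ^ (p - 1)) * v x := by ring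
        rw [h6, abs_mul, abs_mul]
        calc |x ^ (k + 2)| * (|1 - p * u x ^ (p - 1)| * |v x|)
            ≤ 1 * (2 * p ^ 2 * A) := by
              gcongr
              exact hAr x ⟨(hs.1.trans hx.1).le, hx.2.le⟩
          _ = _ := one_mul _
    simp only [g.right, mul_zero, zero_sub, abs_neg] at h1
    refine h1.trans (mul_le_mul_of_nonneg_left (by linarith [hs.1]) (by positivity))
  have hv : ∀ s ∈ Icc T β, |v β - v s| ≤ A / 2 := by
    intro s hs
    have h1 := abs_sub_le_mul_sub_of_abs_hasDerivAt_le
      (C := 2 * p ^ 2 * A * (β - T) / T ^ (k + 2)) hs.2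
      (g.cont.mono (Icc_subset_Icc (hαT.le.trans hs.1) le_rfl))
      (fun x hx => g.hasDeriv x ⟨hαT.trans (hs.1.trans_lt hx.1), hx.2⟩) fun x hx => by
        have h2 := hG x ⟨hs.1.trans_lt hx.1, hx.2⟩
        have h3 : T ^ (k + 2) ≤ x ^ (k + 2) :=
          pow_le_pow_left₀ (h.left_nonneg.trans hαT.le) (hs.1.trans hx.1.le) _
        rw [abs_mul, abs_of_pos (hT0.trans_le h3)] at h2
        rw [le_div_iff₀ hT0]
        have := mul_le_mul_of_nonneg_right h3 (abs_nonneg (y x))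
        linarith
    refine h1.trans ?_
    have h2 : 2 * p ^ 2 * A * (β - T) / T ^ (k + 2) * (β - s) ≤
        2 * p ^ 2 * A * (β - T) / T ^ (k + 2) * (β - T) := by
      have : 0 ≤ β - T := by linarith
      refine mul_le_mul_of_nonneg_left (by linarith [hs.1]) (by positivity)
    refine h2.trans ?_
    rw [div_mul_eq_mul_div, div_le_iff₀ hT0]
    have := mul_le_mul_of_nonneg_right hT hA0
    linarith
  have h1 := hv t ht
  have h2 := abs_sub_abs_le_abs_sub (v t) (v β)
  rw [abs_sub_comm] at h2
  have h3 := hAr r hr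
  linarith

/-- Transport of the bound on kernel elements across a region where the flux is bounded below. -/
theorem abs_le_transport (h : LayerSolution (k + 2) α β p u z)
    (g : Flow (k + 2) α β (fun r => p * u r ^ (p - 1) * v r) v y)
    (hV : ∀ r ∈ Icc α β, |v r| ≤ V) {R T c : ℝ} (hαR : α < R) (hTβ : T < β) (hc : 0 < c)
    (hF : ∀ r ∈ Icc R T, c ≤ r ^ (k + 2) * z r) {r : ℝ} (hr : r ∈ Icc R T) :
    |v r| ≤ 2 * (|v T| / c + (2 * k + 5) * V / c ^ 2 * (T - R)) := by
  have hIcc : ∀ x ∈ Icc R T, x ∈ Icc α β :=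
    fun x hx => ⟨hαR.le.trans hx.1, hx.2.trans hTβ.le⟩
  have hz : ∀ x ∈ Icc R T, c ≤ z x := fun x hx => (hF x hx).trans (h.flux_le_z (hIcc x hx))
  have hV0 : 0 ≤ V := (abs_nonneg _).trans (hV α h.left_mem)
  have hTm : T ∈ Icc R T := ⟨hr.1.trans hr.2, le_rfl⟩
  have hrT : ∀ x ∈ Icc r T, x ∈ Icc R T := fun x hx => ⟨hr.1.trans hx.1, hx.2⟩
  have h1 := abs_sub_le_mul_sub_of_abs_hasDerivAt_le (f := fun s => v s / z s)
    (f' := fun x => wronskian k p u z v y x / (x ^ (k + 2) * z x ^ 2))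
    (C := (2 * k + 5) * V / c ^ 2) hr.2
    ((g.cont.mono fun x hx => hIcc x (hrT x hx)).div
      (h.cont_deriv.mono fun x hx => hIcc x (hrT x hx))
      fun x hx => (hc.trans_le (hz x (hrT x hx))).ne')
    (fun x hx => by
      have hxR := hrT x (Ioo_subset_Icc_self hx)
      have hxI : x ∈ Ioo α β := ⟨hαR.trans_le hxR.1, hx.2.trans hTβ⟩
      have hx0 : 0 < x := h.left_nonneg.trans_lt hxI.1
      have hzx : 0 < z x := hc.trans_le (hz x hxR)
      refine ((g.hasDeriv x hxI).div (h.hasDeriv_deriv x hxI) hzx.ne').congr_deriv ?_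
      rw [wronskian]
      push_cast
      field_simp
      ring)
    (fun x hx => by
      have hxR := hrT x (Ioo_subset_Icc_self hx)
      have hxI := hIcc x hxR
      have h2 := h.abs_wronskian_le g hV hxI
      have h3 : c ^ 2 ≤ x ^ (k + 2) * z x ^ 2 := by
        have h4 := hF x hxR
        have h5 := h.flux_le_z hxI
        nlinarith
      rw [abs_div, abs_of_pos ((by positivity : 0 < c ^ 2).trans_le h3)]
      gcongr)
  have h2 : |v r / z r| ≤ |v T| / c + (2 * k + 5) * V / c ^ 2 * (T - R) := by
    have h3 := abs_sub_abs_le_abs_sub (v r / z r) (v T / z T)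
    rw [abs_sub_comm] at h3
    have h4 : |v T / z T| ≤ |v T| / c := by
      rw [abs_div, abs_of_pos (hc.trans_le (hz T hTm))]
      have := hz T hTm
      gcongr
    have h5 : (2 * k + 5) * V / c ^ 2 * (T - r) ≤ (2 * k + 5) * V / c ^ 2 * (T - R) :=
      mul_le_mul_of_nonneg_left (by linarith [hr.1]) (by positivity)
    linarith
  have h3 : v r = z r * (v r / z r) := by
    have := hc.trans_le (hz r hr)
    field_simp
  rw [h3, abs_mul, abs_of_nonneg (h.z_nonneg (hIcc r hr))]
  exact mul_le_mul ((h.z_le (hIcc r hr)).trans (h.le_two (hIcc r hr))) h2 (abs_nonneg _)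
    (by norm_num)

end LayerSolution

/-! ### Choice of constants and triviality of the kernel -/

theorem eventually_le_mul {A : ℝ} (hA : 0 < A) (B : ℝ) : ∀ᶠ p : ℝ in Filter.atTop, B ≤ A * p :=
  (Filter.tendsto_id.const_mul_atTop hA).eventually_ge_atTop B

theorem mul_rpow_le_one {x θ p : ℝ} (hx : 0 ≤ x) (hθ : 0 < θ) (hxθ : x ≤ 1 - θ) (hp : 2 ≤ p)
    (hpθ : 4 ≤ θ ^ 2 * (p - 1)) : p * x ^ (p - 1) ≤ 1 := by
  have h1 : x ≤ Real.exp (-θ) := by linarith [Real.add_one_le_exp (-θ)]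
  have h2 : x ^ (p - 1) ≤ Real.exp (-(θ * (p - 1))) := by
    refine (Real.rpow_le_rpow hx h1 (by linarith)).trans_eq ?_
    rw [← Real.exp_mul]
    congr 1
    ring
  have h3 : p ≤ Real.exp (θ * (p - 1)) := by
    have h4 : 0 ≤ θ * (p - 1) := mul_nonneg hθ.le (by linarith)
    have h5 := Real.quadratic_le_exp_of_nonneg h4
    nlinarith
  calc p * x ^ (p - 1) ≤ Real.exp (θ * (p - 1)) * Real.exp (-(θ * (p - 1))) :=
        mul_le_mul h3 h2 (Real.rpow_nonneg hx _) (Real.exp_pos _).le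
    _ = 1 := by rw [← Real.exp_add, add_neg_cancel, Real.exp_zero]

set_option maxHeartbeats 2000000 in
/-- For large `p` the linearization at a layer solution has trivial kernel. -/
theorem exists_forall_kernel_eq_zero (k : ℕ) {α β : ℝ} (hα : 0 ≤ α) (hαβ : α < β)
    (hβ : β ≤ 1) : ∃ p₀ : ℝ, ∀ p : ℝ, p₀ ≤ p → ∀ u z v y : ℝ → ℝ,
      LayerSolution (k + 2) α β p u z →
        Flow (k + 2) α β (fun r => p * u r ^ (p - 1) * v r) v y → ∀ r ∈ Icc α β, v r = 0 := by
  set l := β - α with hl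
  have hl0 : 0 < l := by linarith
  have hl1 : l ≤ 1 := by linarith
  set a := α + l / 2 with ha
  have ha0 : 0 < a := by linarith
  have ha1 : a ≤ 1 := by linarith
  set q := a ^ (k + 2) with hq
  have hq0 : 0 < q := by positivity
  have hq1 : q ≤ 1 := pow_le_one₀ ha0.le ha1
  -- This makes 4ε half of q(l/8)², the bound available in `lt_one_sub` with a the midpoint and m =
  -- α + 5l/8.
  set ε := q * l ^ 2 / 512 with hε
  have hε0 : 0 < ε := by positivity
  have hε2 : ε ≤ 1 / 2 := by
    have : q * l ^ 2 ≤ 1 := mul_le_one₀ hq1 (by positivity) (pow_le_one₀ hl0.le hl1)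
    linarith
  obtain ⟨c₀, hc₀⟩ : ∃ c : ℝ, c = (α + l / 4) ^ (k + 2) * (Real.exp (-1) * ε) * (l / 4) :=
    ⟨_, rfl⟩
  have hc₀0 : 0 < c₀ := by
    have : 0 < α + l / 4 := by linarith
    rw [hc₀]; positivity
  obtain ⟨b, hb⟩ : ∃ b : ℝ, b = c₀ ^ 2 / 8 := ⟨_, rfl⟩
  have hb0 : 0 < b := by rw [hb]; positivity
  -- Then 4p²(κ/p)² = q² ≤ q, the width condition of `abs_le_two_mul_abs_right`.
  obtain ⟨κ, hκ⟩ : ∃ κ : ℝ, κ = q / 2 := ⟨_, rfl⟩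
  have hκ0 : 0 < κ := by rw [hκ]; positivity
  have hκ2 : κ ≤ 1 / 2 := by rw [hκ]; linarith
  obtain ⟨c, hc0, hcc₀, hcκ, hc1⟩ :
      ∃ c : ℝ, 0 < c ∧ c ≤ c₀ ∧ c ≤ q * (b / 4) * κ ∧ c ≤ 1 :=
    ⟨min (min c₀ (q * (b / 4) * κ)) 1, by positivity,
      (min_le_left _ _).trans (min_le_left _ _), (min_le_left _ _).trans (min_le_right _ _),
      min_le_right _ _⟩
  -- The transport error (2k+5)Vδ/c² becomes at most V/8.
  obtain ⟨δ, hδ0, hδl, hδc⟩ :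
      ∃ δ : ℝ, 0 < δ ∧ δ ≤ l / 2 ∧ δ ≤ c ^ 2 / (8 * (2 * k + 5)) :=
    ⟨min (l / 2) (c ^ 2 / (8 * (2 * k + 5))), by positivity, min_le_left _ _, min_le_right _ _⟩
  -- d will bound β - S: it keeps S at distance at least δ/2 to the right of β - δ and the energy
  -- loss on [S, β] below c₀²/4.
  obtain ⟨d, hd0, hdl, hdδ, hdc⟩ : ∃ d : ℝ, 0 < d ∧ d ≤ l / 4 ∧ d ≤ δ / 2 ∧
      d ≤ c₀ ^ 2 * a / (16 * (k + 2)) :=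
    ⟨min (min (l / 4) (δ / 2)) (c₀ ^ 2 * a / (16 * (k + 2))), by positivity,
      (min_le_left _ _).trans (min_le_left _ _), (min_le_left _ _).trans (min_le_right _ _),
      min_le_right _ _⟩
  set θ := c₀ * (δ / 2) with hθ
  have hθ0 : 0 < θ := by positivity
  -- The last condition turns |v(β)| · qbp/2 ≤ (2k+5)V into |v(β)| ≤ cV/16.
  have hlarge : ∀ᶠ p : ℝ in Filter.atTop, 2 ≤ p ∧ 1 + ε ≤ ε * p ∧ 4 + 2 * d ^ 2 ≤ d ^ 2 * p ∧
      8 ≤ b * p ∧ κ ≤ δ * p ∧ 4 + θ ^ 2 ≤ θ ^ 2 * p ∧ 32 * (2 * k + 5) ≤ q * b * c * p := by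
    filter_upwards [Filter.eventually_ge_atTop 2, eventually_le_mul hε0 (1 + ε),
      eventually_le_mul (by positivity : 0 < d ^ 2) (4 + 2 * d ^ 2), eventually_le_mul hb0 8,
      eventually_le_mul hδ0 κ, eventually_le_mul (by positivity : 0 < θ ^ 2) (4 + θ ^ 2),
      eventually_le_mul (by positivity : 0 < q * b * c) (32 * (2 * k + 5))]
      with p h1 h2 h3 h4 h5 h6 h7 using ⟨h1, h2, h3, h4, h5, h6, h7⟩
  obtain ⟨p₀, hp₀⟩ := Filter.eventually_atTop.1 hlarge
  refine ⟨p₀, fun p hpp u z v y h g => ?_⟩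
  obtain ⟨hp2, hpε, hpd, hpb, hpκ, hpθ, hpV⟩ := hp₀ p hpp
  have hp0 : 0 < p := by linarith
  obtain ⟨S, hS, hS1⟩ := h.exists_eq_one
  have hSI := Ioo_subset_Icc_self hS
  have hSd : β - S ≤ d := by
    have h1 := h.sub_sq_le hS hS1
    by_contra! hcon
    have h2 : d ^ 2 < (β - S) ^ 2 := pow_lt_pow_left₀ hcon hd0.le (by norm_num)
    nlinarith [sq_nonneg d]
  -- the flux entering the layer
  have hua : u a < 1 - ε := by
    refine h.lt_one_sub hS hS1 (m := α + 5 * l / 8) (by linarith) (by linarith) (by linarith)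
      hε0 hε2 (by linarith) ?_
    have h1 : l / 8 ≤ S - (α + 5 * l / 8) := by linarith
    have h2 : α + 5 * l / 8 - a = l / 8 := by rw [ha]; ring
    rw [h2]
    calc 4 * ε < q * (l / 8) * (l / 8) := by
          have := mul_pos hq0 (pow_pos hl0 2)
          rw [hε]; linarith
      _ ≤ _ := mul_le_mul_of_nonneg_left h1 (by positivity)
  have haS : a < S := by linarith
  have hFa : c₀ ≤ a ^ (k + 2) * z a := by
    have h1 := h.le_flux hS hS1 (a := α + l / 4) (b := a) (by linarith) (by linarith) haS hε0 hua
    have h2 : a - (α + l / 4) = l / 4 := by rw [ha]; ring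
    rwa [h2, ← hc₀] at h1
  have hFS : ∀ r, a ≤ r → r ≤ S → c₀ ≤ r ^ (k + 2) * z r := fun r har hrS =>
    hFa.trans (h.flux_le_flux_left hSI hS1 (by linarith) har hrS)
  -- the height of the layer
  have hM : b * p ≤ u β ^ p := by
    rw [hb]
    refine h.le_rpow_right hS hS1 ha0 haS.le hc₀0.le (hFS S haS.le le_rfl) ?_
    have h1 := hSd.trans hdc
    rw [le_div_iff₀ (by positivity)] at h1
    rw [div_mul_eq_mul_div, div_le_iff₀ ha0]
    push_cast
    linarith
  -- the layer region
  have hκp : 0 < κ / p := div_pos hκ0 hp0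
  have hκδ : κ / p ≤ δ := by rw [div_le_iff₀ hp0]; exact hpκ
  obtain ⟨T, hT⟩ : ∃ T : ℝ, T = β - κ / p := ⟨_, rfl⟩
  obtain ⟨R, hR⟩ : ∃ R : ℝ, R = β - δ := ⟨_, rfl⟩
  have haR : a ≤ R := by rw [hR, ha]; linarith
  have hRT : R ≤ T := by rw [hR, hT]; linarith
  have hTβ : T < β := by rw [hT]; linarith
  have hαR : α < R := by linarith
  have hFT : q * (b / 4) * κ ≤ T ^ (k + 2) * z T := by
    rw [hT]
    exact h.le_flux_layer ha0 hκ0 hκ2 (by linarith) (by linarith) hb0.le hM hpb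
  have hF : ∀ r ∈ Icc R T, c ≤ r ^ (k + 2) * z r := by
    intro r hr
    rcases le_total r S with hrS | hrS
    · exact hcc₀.trans (hFS r (haR.trans hr.1) hrS)
    · exact hcκ.trans (hFT.trans (h.flux_le_flux_right hSI hS1 hrS hr.2 hTβ.le))
  have hRS : R ≤ S := by rw [hR]; linarith
  have huR : p * u R ^ (p - 1) ≤ 1 := by
    refine mul_rpow_le_one (h.nonneg R ⟨hαR.le, hRS.trans hS.2.le⟩) hθ0 ?_ hp2 (by linarith)
    have h1 := mul_sub_le_sub_of_le_hasDerivAt (C := c₀) hRS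
      (h.cont.mono (Icc_subset_Icc hαR.le hS.2.le))
      (fun x hx => h.hasDeriv x ⟨hαR.trans hx.1, hx.2.trans hS.2⟩) fun x hx =>
        (hFS x (haR.trans hx.1.le) hx.2.le).trans
          (h.flux_le_z ⟨(hαR.trans hx.1).le, (hx.2.trans hS.2).le⟩)
    have h2 : c₀ * (δ / 2) ≤ c₀ * (S - R) :=
      mul_le_mul_of_nonneg_left (by rw [hR]; linarith) hc₀0.le
    rw [hS1] at h1
    linarith
  -- the maximum of the kernel element
  obtain ⟨t, ht, htm⟩ := isCompact_Icc.exists_isMaxOn (nonempty_Icc.2 hαβ.le) g.cont.abs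
  obtain ⟨V, hVt⟩ : ∃ V : ℝ, V = |v t| := ⟨_, rfl⟩
  have hV : ∀ r ∈ Icc α β, |v r| ≤ V := fun r hr => hVt ▸ htm hr
  have hV0 : 0 ≤ V := hVt ▸ abs_nonneg _
  have hvβ : |v β| ≤ c * V / 16 := by
    have h1 := h.abs_right_mul_le g hV
    have h2 : q ≤ β ^ (k + 2) := pow_le_pow_left₀ ha0.le (by linarith) _
    have h3 : b * p / 2 ≤ u β ^ p - u β := by linarith [h.right_le_two]
    have h4 : q * (b * p / 2) ≤ β ^ (k + 2) * (u β ^ p - u β) :=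
      mul_le_mul h2 h3 (by positivity) (hq0.le.trans h2)
    have h5 : |v β| * (q * (b * p / 2)) ≤ (2 * k + 5) * V :=
      (mul_le_mul_of_nonneg_left h4 (abs_nonneg _)).trans h1
    have h6 := mul_le_mul_of_nonneg_right hpV hV0
    have h7 : |v β| * (q * (b * p / 2)) ≤ c * V / 16 * (q * (b * p / 2)) := by linarith
    exact le_of_mul_le_mul_right h7 (by positivity)
  have hlayer : ∀ r ∈ Icc T β, |v r| ≤ c * V / 8 := by
    intro r hr
    have hTa : a ≤ T := haR.trans hRT
    refine (h.abs_le_two_mul_abs_right g (by linarith) hTβ.le ?_ hr).trans (by linarith)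
    have h1 : q ≤ T ^ (k + 2) := pow_le_pow_left₀ ha0.le hTa _
    have h2 : 4 * p ^ 2 * (β - T) ^ 2 = q ^ 2 := by
      rw [hT, hκ]
      field_simp
      ring
    rw [h2]
    nlinarith
  have hcV : c * V ≤ V := mul_le_of_le_one_left hV0 hc1
  have hhalf : ∀ r ∈ Icc R β, |v r| ≤ V / 2 := by
    intro r hr
    rcases le_total T r with hTr | hTr
    · linarith [hlayer r ⟨hTr, hr.2⟩]
    · have h1 := h.abs_le_transport g hV hαR hTβ hc0 hF ⟨hr.1, hTr⟩
      have h2 : |v T| / c ≤ V / 8 := by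
        rw [div_le_iff₀ hc0]
        linarith [hlayer T ⟨le_rfl, hTβ.le⟩]
      have h3 : (2 * k + 5) * V / c ^ 2 * (T - R) ≤ V / 8 := by
        have h4 : T - R ≤ c ^ 2 / (8 * (2 * k + 5)) := by
          refine le_trans ?_ hδc
          rw [hR]; linarith
        refine (mul_le_mul_of_nonneg_left h4 (by positivity)).trans_eq ?_
        field_simp
      linarith
  have hVhalf : V ≤ V / 2 := by
    rcases le_total R t with hRt | hRt
    · exact hVt ▸ hhalf t ⟨hRt, ht.2⟩
    · have h1 := h.sq_le_sq_left g ⟨hαR.le, hRS.trans hS.2.le⟩ huR ht.1 hRt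
      rw [sq_le_sq] at h1
      have h2 := hhalf R ⟨le_rfl, hRS.trans hS.2.le⟩
      linarith
  intro r hr
  have h1 := hV r hr
  exact abs_nonpos_iff.1 (by linarith)

/-! ### The domain and weak gradients -/

section Annulus

variable {N : ℕ} {α β : ℝ}

theorem isOpen_annulus : IsOpen (annulus N α β) := by
  have h1 : IsOpen {x : EuclideanSpace ℝ (Fin N) | 0 < α → α < ‖x‖} := by
    by_cases h : 0 < α
    · simpa [h] using isOpen_lt continuous_const continuous_norm
    · simp [h]
  exact h1.inter (isOpen_lt continuous_norm continuous_const)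

theorem norm_mem_Icc_of_mem_annulus (hα : 0 ≤ α) {x : EuclideanSpace ℝ (Fin N)}
    (hx : x ∈ annulus N α β) : ‖x‖ ∈ Icc α β := by
  refine ⟨?_, hx.2.le⟩
  rcases hα.eq_or_lt with h | h
  · rw [← h]; exact norm_nonneg x
  · exact (hx.1 h).le

theorem volume_annulus_lt_top : volume (annulus N α β) < ⊤ := by
  refine (measure_mono fun x hx => ?_).trans_lt (measure_ball_lt_top (x := 0) (r := β))
  simpa using hx.2

theorem exists_norm_eq_mem_annulus (hN : 0 < N) (hα : 0 ≤ α) {r : ℝ} (hr : r ∈ Ioo α β) :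
    ∃ x ∈ annulus N α β, ‖x‖ = r := by
  have : Nonempty (Fin N) := ⟨⟨0, hN⟩⟩
  obtain ⟨x, hx⟩ := exists_norm_eq (EuclideanSpace ℝ (Fin N)) (hα.trans hr.1.le)
  exact ⟨x, ⟨fun _ => hx ▸ hr.1, hx ▸ hr.2⟩, hx⟩

end Annulus

section Sobolev

variable {N : ℕ} {Ω : Set (EuclideanSpace ℝ (Fin N))} {f : EuclideanSpace ℝ (Fin N) → ℝ}
  {g g₁ g₂ : EuclideanSpace ℝ (Fin N) → EuclideanSpace ℝ (Fin N)}

theorem MemH1.isH1Pair_weakGrad (h : MemH1 Ω f) : IsH1Pair Ω f (weakGrad Ω f) := by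
  rw [weakGrad, dif_pos h]
  exact h.choose_spec

/-- Weak gradients are unique almost everywhere. -/
theorem IsH1Pair.ae_eq (hΩ : IsOpen Ω) (h₁ : IsH1Pair Ω f g₁) (h₂ : IsH1Pair Ω f g₂) :
    g₁ =ᵐ[volume.restrict Ω] g₂ := by
  have hl₁ : LocallyIntegrable g₁ (volume.restrict Ω) := h₁.2.1.locallyIntegrable (by norm_num)
  have hl₂ : LocallyIntegrable g₂ (volume.restrict Ω) := h₂.2.1.locallyIntegrable (by norm_num)
  have key := hΩ.ae_eq_zero_of_integral_contDiff_smul_eq_zero (μ := volume.restrict Ω)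
    (f := fun x => g₁ x - g₂ x) ((hl₁.sub hl₂).locallyIntegrableOn Ω) fun φ hφ hc hs => by
      have hi : ∀ {g : EuclideanSpace ℝ (Fin N) → EuclideanSpace ℝ (Fin N)},
          LocallyIntegrable g (volume.restrict Ω) →
          Integrable (fun x => φ x • g x) (volume.restrict Ω) := fun hg =>
        hg.integrable_smul_left_of_hasCompactSupport hφ.continuous hc
      simp only [smul_sub]
      rw [integral_sub (hi hl₁) (hi hl₂), sub_eq_zero]
      refine ext_inner_left ℝ fun e => ?_
      rw [← integral_inner (hi hl₁), ← integral_inner (hi hl₂)]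
      have e₁ := h₁.2.2 φ hφ hc hs e
      have e₂ := h₂.2.2 φ hφ hc hs e
      rw [e₁] at e₂
      have e₃ := neg_injective e₂
      simp only [real_inner_comm _ e, real_inner_smul_left]
      simpa only [mul_comm] using e₃
  filter_upwards [key, ae_restrict_mem hΩ.measurableSet] with x hx hxΩ
  exact sub_eq_zero.1 (hx hxΩ)

/-- Uniqueness lets any explicit weak gradient replace the arbitrarily chosen one. -/
theorem IsH1Pair.H1NormSq_eq (hΩ : IsOpen Ω) (h : IsH1Pair Ω f g) :
    H1NormSq Ω f = ∫ x in Ω, (‖g x‖ ^ 2 + f x ^ 2) := by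
  refine integral_congr_ae ?_
  filter_upwards [IsH1Pair.ae_eq hΩ (MemH1.isH1Pair_weakGrad ⟨g, h⟩) h] with x hx
  rw [hx]

theorem MemH1.integral_sq_le (h : MemH1 Ω f) : ∫ x in Ω, f x ^ 2 ≤ H1NormSq Ω f := by
  have h1 := h.isH1Pair_weakGrad
  refine integral_mono h1.1.integrable_sq
    ((h1.2.1.integrable_norm_pow (by norm_num)).add h1.1.integrable_sq) fun x => ?_
  simp only [le_add_iff_nonneg_left]
  positivity

/-- Test functions vanish off Ω, so both integrals extend to the whole space, where integration by
parts has no boundary term. -/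
theorem isWeakGradient_of_hasFDerivAt (hf : Continuous f) (hg : Continuous g)
    (h : ∀ x, HasFDerivAt f (innerSL ℝ (g x)) x) : IsWeakGradient Ω f g := by
  intro φ hφ hc hs e
  have hd : ∀ x, fderiv ℝ f x e = inner ℝ (g x) e := fun x => by
    rw [(h x).fderiv, innerSL_apply_apply]
  have hφ' : Continuous fun x => fderiv ℝ φ x e :=
    (hφ.continuous_fderiv (by simp)).clm_apply continuous_const
  have hcd : HasCompactSupport fun x => fderiv ℝ φ x e := hc.fderiv_apply ℝ e
  have hφ0 : ∀ x, x ∉ Ω → φ x = 0 := fun x hx => image_eq_zero_of_notMem_tsupport fun h' =>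
    hx (hs h')
  have hφ0' : ∀ x, x ∉ Ω → fderiv ℝ φ x e = 0 := fun x hx => by
    have h1 : x ∉ tsupport (fderiv ℝ φ) := fun h' => hx (hs (tsupport_fderiv_subset ℝ h'))
    rw [image_eq_zero_of_notMem_tsupport h1]
    rfl
  rw [setIntegral_eq_integral_of_forall_compl_eq_zero fun x hx => by rw [hφ0' x hx, mul_zero],
    setIntegral_eq_integral_of_forall_compl_eq_zero fun x hx => by rw [hφ0 x hx, mul_zero]]
  simp only [← hd]
  refine integral_mul_fderiv_eq_neg_fderiv_mul_of_integrable ?_ ?_ ?_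
    (fun x _ => (h x).differentiableAt) fun x _ => hφ.differentiable (by simp) x
  · simp only [hd]
    exact ((hg.inner continuous_const).mul hφ.continuous).integrable_of_hasCompactSupport
      hc.mul_left
  · exact (hf.mul hφ').integrable_of_hasCompactSupport hcd.mul_left
  · exact (hf.mul hφ.continuous).integrable_of_hasCompactSupport hc.mul_left

end Sobolev

/-! ### Constants are not minimizers for large p -/

section Minimality

variable {N : ℕ} {α β : ℝ}

/-- The quotient of a positive constant is at least that of the function `1`. -/
theorem le_Q_of_forall_eq (hα : 0 ≤ α) {p t : ℝ} {u : ℝ → ℝ} (hp : 1 < p) (ht : 0 < t)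
    (hA : 0 < volume.real (annulus N α β)) (hu : ∀ r ∈ Icc α β, u r = t)
    (hH : MemH1 (annulus N α β) (radial N u)) :
    volume.real (annulus N α β) / (volume.real (annulus N α β) ^ (1 / (p + 1))) ^ 2 ≤
      Q N α β p u := by
  have hr : ∀ x ∈ annulus N α β, radial N u x = t := fun x hx =>
    hu _ (norm_mem_Icc_of_mem_annulus hα hx)
  have hm : MeasurableSet (annulus N α β) := isOpen_annulus.measurableSet
  have h1 : ∫ x in annulus N α β, radial N u x ^ 2 = volume.real (annulus N α β) * t ^ 2 := by
    rw [setIntegral_congr_fun hm (g := fun _ => t ^ 2) fun x hx => by simp only [hr x hx]]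
    simp
  have h2 : LNorm (annulus N α β) (p + 1) (radial N u) =
      t * volume.real (annulus N α β) ^ (1 / (p + 1)) := by
    rw [LNorm, setIntegral_congr_fun hm (g := fun _ => t ^ (p + 1)) fun x hx => by
      simp only [hr x hx, abs_of_pos ht]]
    rw [setIntegral_const, smul_eq_mul, Real.mul_rpow hA.le (by positivity), ← Real.rpow_mul ht.le,
      mul_one_div_cancel (by linarith), Real.rpow_one, mul_comm]
  -- A lower bound suffices, so the gradient term is dropped without computing it.
  have h3 := hH.integral_sq_le
  rw [h1] at h3
  rw [Q, h2]
  have h4 : 0 < volume.real (annulus N α β) ^ (1 / (p + 1)) := by positivity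
  rw [div_le_div_iff₀ (by positivity) (by positivity)]
  calc _ = (volume.real (annulus N α β) * t ^ 2) *
        (volume.real (annulus N α β) ^ (1 / (p + 1))) ^ 2 := by ring
    _ ≤ _ := mul_le_mul_of_nonneg_right h3 (by positivity)

theorem Q_nonneg (p : ℝ) (u : ℝ → ℝ) : 0 ≤ Q N α β p u :=
  div_nonneg (integral_nonneg fun x => by positivity) (sq_nonneg _)

theorem cPlus_le {p : ℝ} {u : ℝ → ℝ} (hu : u ∈ admissible N α β) :
    cPlus N α β p ≤ Q N α β p u := by
  refine csInf_le ⟨0, ?_⟩ (mem_image_of_mem _ hu)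
  rintro _ ⟨w, -, rfl⟩
  exact Q_nonneg p w

/-- A smooth radially increasing profile, close to `1` for small `ε`. -/
def testProfile (β ε r : ℝ) : ℝ := 1 - ε * (β ^ 2 - r ^ 2)

theorem testProfile_mem_Icc (hβ : β ≤ 1) {ε r : ℝ} (hε : 0 ≤ ε) (hε1 : ε ≤ 1)
    (hr : r ∈ Icc 0 β) : testProfile β ε r ∈ Icc 0 1 := by
  have h1 : 0 ≤ β ^ 2 - r ^ 2 := by nlinarith [hr.1, hr.2]
  have h2 : β ^ 2 - r ^ 2 ≤ 1 := by nlinarith [hr.1, hr.2]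
  rw [testProfile]
  exact ⟨by nlinarith, by nlinarith⟩

theorem continuous_radial_testProfile {ε : ℝ} :
    Continuous (radial N (testProfile β ε)) := by
  unfold radial testProfile
  fun_prop

theorem isH1Pair_testProfile (hα : 0 ≤ α) (hβ : β ≤ 1) {ε : ℝ} (hε : 0 ≤ ε) (hε1 : ε ≤ 1) :
    IsH1Pair (annulus N α β) (radial N (testProfile β ε)) fun x => (2 * ε) • x := by
  have hm : MeasurableSet (annulus N α β) := isOpen_annulus.measurableSet
  have : IsFiniteMeasure (volume.restrict (annulus N α β)) :=
    isFiniteMeasure_restrict.2 volume_annulus_lt_top.ne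
  have hg : Continuous fun x : EuclideanSpace ℝ (Fin N) => (2 * ε) • x := by fun_prop
  refine ⟨?_, ?_, isWeakGradient_of_hasFDerivAt continuous_radial_testProfile hg fun x => ?_⟩
  · refine MemLp.of_bound continuous_radial_testProfile.aestronglyMeasurable 1 ?_
    filter_upwards [ae_restrict_mem hm] with x hx
    have hx' := norm_mem_Icc_of_mem_annulus hα hx
    have h1 := testProfile_mem_Icc hβ hε hε1 ⟨norm_nonneg x, hx'.2⟩
    rw [radial, Real.norm_of_nonneg h1.1]
    exact h1.2
  · refine MemLp.of_bound hg.aestronglyMeasurable 2 ?_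
    filter_upwards [ae_restrict_mem hm] with x hx
    have hx' := norm_mem_Icc_of_mem_annulus hα hx
    rw [norm_smul, Real.norm_of_nonneg (by linarith)]
    nlinarith [norm_nonneg x, hx'.2]
  · have h1 := (((hasStrictFDerivAt_norm_sq x).hasFDerivAt.const_sub (β ^ 2)).const_mul
      ε).const_sub 1
    refine h1.congr_fderiv ?_
    ext e
    simp
    ring

theorem testProfile_mem_admissible (hα : 0 ≤ α) (hαβ : α < β) (hβ : β ≤ 1) {ε : ℝ}
    (hε : 0 ≤ ε) (hε1 : ε ≤ 1) : testProfile β ε ∈ admissible N α β := by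
  refine ⟨⟨⟨_, isH1Pair_testProfile hα hβ hε hε1⟩, ?_, fun r hr => ?_, fun r hr s hs hrs => ?_⟩,
    ⟨β, ⟨hαβ.le, le_rfl⟩, by simp [testProfile]⟩, ?_⟩
  · unfold testProfile
    fun_prop
  · exact (testProfile_mem_Icc hβ hε hε1 ⟨hα.trans hr.1, hr.2⟩).1
  · have h1 : r ^ 2 ≤ s ^ 2 := pow_le_pow_left₀ (hα.trans hr.1) hrs 2
    unfold testProfile
    nlinarith
  · rw [eLpNorm_exponent_top]
    refine (eLpNormEssSup_le_of_ae_bound (C := 1) ?_).trans_lt ?_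
    · filter_upwards [ae_restrict_mem isOpen_annulus.measurableSet] with x hx
      have hx' := norm_mem_Icc_of_mem_annulus hα hx
      have h1 := testProfile_mem_Icc hβ hε hε1 ⟨norm_nonneg x, hx'.2⟩
      rw [radial, Real.norm_of_nonneg h1.1]
      exact h1.2
    · have h1 : 0 < √(Real.exp 1) := Real.sqrt_pos.2 (Real.exp_pos 1)
      exact (ENNReal.ofReal_lt_ofReal_iff (by linarith)).2 (by linarith)

theorem volume_real_pos_of_isOpen {U : Set (EuclideanSpace ℝ (Fin N))} (hU : IsOpen U)
    (hne : U.Nonempty) (hsub : U ⊆ annulus N α β) : 0 < volume.real U :=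
  ENNReal.toReal_pos (hU.measure_pos volume hne).ne'
    ((measure_mono hsub).trans_lt volume_annulus_lt_top).ne

/-- Some test profile has smaller `H¹` norm than the constant `1`. -/
theorem exists_H1NormSq_testProfile_lt (hN : 0 < N) (hα : 0 ≤ α) (hαβ : α < β) (hβ : β ≤ 1) :
    ∃ ε ∈ Icc (0 : ℝ) 1,
      H1NormSq (annulus N α β) (radial N (testProfile β ε)) < volume.real (annulus N α β) := by
  set Ω := annulus N α β
  have hm : MeasurableSet Ω := isOpen_annulus.measurableSet
  have : IsFiniteMeasure (volume.restrict Ω) :=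
    isFiniteMeasure_restrict.2 volume_annulus_lt_top.ne
  have hA : 0 < volume.real Ω := by
    obtain ⟨x, hx, -⟩ := exists_norm_eq_mem_annulus hN hα (r := (α + β) / 2) (β := β)
      ⟨by linarith, by linarith⟩
    exact volume_real_pos_of_isOpen isOpen_annulus ⟨x, hx⟩ le_rfl
  set d : EuclideanSpace ℝ (Fin N) → ℝ := fun x => β ^ 2 - ‖x‖ ^ 2 with hd
  have hdc : Continuous d := by fun_prop
  have hdm : ∀ x ∈ Ω, 0 < d x ∧ d x ≤ 1 := fun x hx => by
    have h1 := hx.2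
    have h2 := norm_nonneg x
    exact ⟨by simp only [hd]; nlinarith, by simp only [hd]; nlinarith⟩
  have hdi : Integrable d (volume.restrict Ω) := by
    refine Integrable.of_bound hdc.aestronglyMeasurable 1 ?_
    filter_upwards [ae_restrict_mem hm] with x hx
    rw [Real.norm_of_nonneg (hdm x hx).1.le]
    exact (hdm x hx).2
  obtain ⟨G, hG⟩ : ∃ G : ℝ, G = ∫ x in Ω, d x := ⟨_, rfl⟩
  have hG0 : 0 < G := by
    rw [hG, setIntegral_pos_iff_support_of_nonneg_ae]
    · have h1 : Ω ⊆ Function.support d ∩ Ω := fun x hx => ⟨(hdm x hx).1.ne', hx⟩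
      exact (ENNReal.toReal_pos_iff.1 hA).1.trans_le (measure_mono h1)
    · filter_upwards [ae_restrict_mem hm] with x hx using (hdm x hx).1.le
    · exact hdi
  have hGA : G ≤ volume.real Ω := by
    have h1 : ∫ x in Ω, d x ≤ ∫ _ in Ω, (1 : ℝ) :=
      setIntegral_mono_on hdi (integrable_const _) hm fun x hx => (hdm x hx).2
    simpa [hG] using h1
  -- The integrand is at most 1 + 5ε² - 2εd; this ε makes the integral of 5ε² equal to εG, half the
  -- gain 2εG.
  obtain ⟨ε, hε⟩ : ∃ ε : ℝ, ε = G / (5 * volume.real Ω) := ⟨_, rfl⟩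
  have hε0 : 0 < ε := by rw [hε]; positivity
  have hε1 : ε ≤ 1 := by rw [hε, div_le_one (by positivity)]; linarith
  refine ⟨ε, ⟨hε0.le, hε1⟩, ?_⟩
  rw [(isH1Pair_testProfile hα hβ hε0.le hε1).H1NormSq_eq isOpen_annulus]
  have h1 : ∫ x in Ω, (‖(2 * ε) • x‖ ^ 2 + radial N (testProfile β ε) x ^ 2) ≤
      ∫ x in Ω, ((1 + 5 * ε ^ 2) - 2 * ε * d x) := by
    have hpair := isH1Pair_testProfile (N := N) hα hβ hε0.le hε1
    refine setIntegral_mono_on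
      ((hpair.2.1.integrable_norm_pow (by norm_num)).add hpair.1.integrable_sq)
      ((integrable_const _).sub (hdi.const_mul _)) hm fun x hx => ?_
    have h2 := hdm x hx
    have h3 := norm_nonneg x
    have h4 : ‖x‖ ≤ 1 := hx.2.le.trans hβ
    have h5 : radial N (testProfile β ε) x = 1 - ε * d x := rfl
    have h6 : ‖x‖ ^ 2 ≤ 1 := by nlinarith
    have h7 : d x ^ 2 ≤ 1 := by nlinarith [h2.1, h2.2]
    rw [norm_smul, Real.norm_of_nonneg (by linarith), h5]
    nlinarith [mul_le_mul_of_nonneg_left h6 (sq_nonneg ε),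
      mul_le_mul_of_nonneg_left h7 (sq_nonneg ε)]
  refine h1.trans_lt ?_
  rw [integral_sub (integrable_const _) (hdi.const_mul _), integral_const_mul, ← hG]
  have h2 : 5 * ε * volume.real Ω = G := by rw [hε]; field_simp
  simp only [integral_const, measureReal_restrict_apply_univ, smul_eq_mul]
  nlinarith [mul_pos hε0 hG0]

/-- For large `p` the constant functions do not achieve the minimal level. -/
theorem exists_forall_cPlus_lt (hN : 0 < N) (hα : 0 ≤ α) (hαβ : α < β) (hβ : β ≤ 1) :
    ∃ p₀ : ℝ, ∀ p : ℝ, p₀ ≤ p → cPlus N α β p <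
      volume.real (annulus N α β) / (volume.real (annulus N α β) ^ (1 / (p + 1))) ^ 2 := by
  obtain ⟨ε, hε, hlt⟩ := exists_H1NormSq_testProfile_lt hN hα hαβ hβ
  have hadm := testProfile_mem_admissible (N := N) hα hαβ hβ hε.1 hε.2
  have hm : MeasurableSet (annulus N α β) := isOpen_annulus.measurableSet
  have hfin : IsFiniteMeasure (volume.restrict (annulus N α β)) :=
    isFiniteMeasure_restrict.2 volume_annulus_lt_top.ne
  obtain ⟨A, hA⟩ : ∃ A, A = volume.real (annulus N α β) := ⟨_, rfl⟩
  obtain ⟨H, hH⟩ : ∃ H, H = H1NormSq (annulus N α β) (radial N (testProfile β ε)) := ⟨_, rfl⟩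
  rw [← hA, ← hH] at hlt
  have hH0 : 0 ≤ H := hH ▸ integral_nonneg fun x => by positivity
  have hA0 : 0 < A := hH0.trans_lt hlt
  -- The profile is at least τ on the set B of measure m > 0, so its quotient is at most H/(τ
  -- m^{1/(p+1)})². This beats the constant once H/A < τ²(m/A)^{2/(p+1)}, whose right side tends to
  -- τ².
  obtain ⟨τ, hτ, hτ1⟩ : ∃ τ : ℝ, √(H / A) < τ ∧ τ < 1 := by
    refine exists_between ?_
    rw [Real.sqrt_lt' one_pos, one_pow, div_lt_one hA0]
    exact hlt
  have hτ0 : 0 < τ := (Real.sqrt_nonneg _).trans_lt hτ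
  have hHτ : H / A < τ ^ 2 := (Real.sqrt_lt' hτ0).1 hτ
  set B : Set (EuclideanSpace ℝ (Fin N)) :=
    annulus N α β ∩ {x | β ^ 2 - ‖x‖ ^ 2 < 1 - τ} with hB
  have hBo : IsOpen B := isOpen_annulus.inter (isOpen_lt (by fun_prop) continuous_const)
  obtain ⟨m, hmB⟩ : ∃ m, m = volume.real B := ⟨_, rfl⟩
  have hm0 : 0 < m := by
    rw [hmB]
    refine volume_real_pos_of_isOpen hBo ?_ inter_subset_left
    have h1 : 0 < min ((β - α) / 2) ((1 - τ) / 4) :=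
      lt_min (by linarith) (by linarith)
    have h2 := min_le_left ((β - α) / 2) ((1 - τ) / 4)
    have h3 := min_le_right ((β - α) / 2) ((1 - τ) / 4)
    obtain ⟨x, hx, hxr⟩ := exists_norm_eq_mem_annulus hN hα (β := β)
      (r := β - min ((β - α) / 2) ((1 - τ) / 4)) ⟨by linarith, by linarith⟩
    refine ⟨x, hx, ?_⟩
    rw [mem_ofPred_eq, hxr]
    nlinarith
  have hlim : Filter.Tendsto (fun p : ℝ => τ ^ 2 * ((m / A) ^ (1 / (p + 1))) ^ 2)
      Filter.atTop (nhds (τ ^ 2)) := by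
    have h1 : Filter.Tendsto (fun p : ℝ => 1 / (p + 1)) Filter.atTop (nhds 0) := by
      simp only [one_div]
      exact Filter.Tendsto.inv_tendsto_atTop (Filter.tendsto_atTop_add_const_right _ _
        Filter.tendsto_id)
    have h2 := (((tendsto_const_nhds (x := m / A)).rpow h1 (Or.inl (by positivity))).pow 2).const_mul (τ ^ 2)
    simpa using h2
  obtain ⟨p₀, hp₀⟩ := Filter.eventually_atTop.1 (hlim.eventually_const_lt hHτ)
  refine ⟨max p₀ 1, fun p hp => (cPlus_le hadm).trans_lt ?_⟩
  have hpA := hp₀ p ((le_max_left _ _).trans hp)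
  have hp1 : 1 ≤ p := (le_max_right _ _).trans hp
  have hL : τ * m ^ (1 / (p + 1)) ≤
      LNorm (annulus N α β) (p + 1) (radial N (testProfile β ε)) := by
    have h1 : τ * m ^ (1 / (p + 1)) = (m * τ ^ (p + 1)) ^ (1 / (p + 1)) := by
      rw [Real.mul_rpow hm0.le (by positivity), ← Real.rpow_mul hτ0.le,
        mul_one_div_cancel (by linarith), Real.rpow_one, mul_comm]
    rw [h1, LNorm]
    refine Real.rpow_le_rpow (by positivity) ?_ (by positivity)
    have hint : IntegrableOn (fun x => |radial N (testProfile β ε) x| ^ (p + 1))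
        (annulus N α β) := by
      refine Integrable.of_bound ((continuous_radial_testProfile.abs.rpow_const
        fun _ => Or.inr (by linarith)).aestronglyMeasurable) 1 ?_
      filter_upwards [ae_restrict_mem hm] with x hx
      have h2 := testProfile_mem_Icc hβ hε.1 hε.2
        ⟨norm_nonneg x, (norm_mem_Icc_of_mem_annulus hα hx).2⟩
      rw [Real.norm_of_nonneg (by positivity), radial, abs_of_nonneg h2.1]
      exact Real.rpow_le_one h2.1 h2.2 (by linarith)
    calc m * τ ^ (p + 1) = ∫ _ in B, τ ^ (p + 1) := by
          rw [setIntegral_const, smul_eq_mul, hmB]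
      _ ≤ ∫ x in B, |radial N (testProfile β ε) x| ^ (p + 1) := by
          refine setIntegral_mono_on ?_ (hint.mono_set inter_subset_left) hBo.measurableSet
            fun x hx => ?_
          · exact integrableOn_const
              ((measure_mono inter_subset_left).trans_lt volume_annulus_lt_top).ne
          · refine Real.rpow_le_rpow hτ0.le ((?_ : τ ≤ _).trans (le_abs_self _)) (by linarith)
            have h2 : β ^ 2 - ‖x‖ ^ 2 < 1 - τ := hx.2
            have h3 := (norm_mem_Icc_of_mem_annulus hα hx.1).2
            have h4 := norm_nonneg x
            have h5 : 0 ≤ β ^ 2 - ‖x‖ ^ 2 := by nlinarith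
            have h6 : radial N (testProfile β ε) x = 1 - ε * (β ^ 2 - ‖x‖ ^ 2) := rfl
            rw [h6]
            nlinarith [hε.2]
      _ ≤ _ := setIntegral_mono_set hint
          (Filter.Eventually.of_forall fun x => by positivity)
          (Filter.Eventually.of_forall fun x hx => hx.1)
  rw [Q, ← hA, ← hH]
  have hmp : 0 < m ^ (1 / (p + 1)) := by positivity
  have hAp : 0 < A ^ (1 / (p + 1)) := by positivity
  rw [Real.div_rpow hm0.le hA0.le, div_pow, div_lt_iff₀ hA0] at hpA
  have h1 : H * (A ^ (1 / (p + 1))) ^ 2 < A * (τ * m ^ (1 / (p + 1))) ^ 2 := by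
    have h2 := mul_lt_mul_of_pos_right hpA (by positivity : 0 < (A ^ (1 / (p + 1))) ^ 2)
    refine h2.trans_eq ?_
    field_simp
  rw [div_lt_div_iff₀ (by have := (mul_pos hτ0 hmp).trans_le hL; positivity) (by positivity)]
  exact h1.trans_le (mul_le_mul_of_nonneg_left (pow_le_pow_left₀ (by positivity) hL 2) hA0.le)

end Minimality

/-! ### Conclusion -/

/-- For large `p` an increasing solution is a layer solution. -/
theorem IsIncreasingSolution.exists_layerSolution {N : ℕ} {α β p : ℝ} {u : ℝ → ℝ} (hα : 0 ≤ α)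
    (hαβ : α < β) (hβ : β ≤ 1) (hp : 2 ≤ p) (hN : 0 < N)
    (hc : cPlus N α β p <
      volume.real (annulus N α β) / (volume.real (annulus N α β) ^ (1 / (p + 1))) ^ 2)
    (hu : IsIncreasingSolution N α β p u) : ∃ z, LayerSolution (N - 1) α β p u z := by
  have hcont := hu.memCone.continuousOn
  obtain ⟨z, hz⟩ := hu.solves.exists_flow hα hαβ hβ
    (hcont.rpow_const fun _ _ => Or.inr (by linarith))
  obtain ⟨t, ht, hadm, hQ⟩ := hu.achieves
  have hne0 : ∃ r ∈ Icc α β, u r ≠ 0 := by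
    obtain ⟨r, hr, hr0⟩ := hadm.2.1
    exact ⟨r, hr, right_ne_zero_of_mul hr0⟩
  -- The only use of minimality: if u ≡ 1, a positive constant would achieve the level, against
  -- `hc`.
  have hne1 : ∃ r ∈ Icc α β, u r ≠ 1 := by
    by_contra! hcon
    obtain ⟨x, hx, -⟩ := exists_norm_eq_mem_annulus hN hα (r := (α + β) / 2) (β := β)
      ⟨by linarith, by linarith⟩
    have h1 := le_Q_of_forall_eq hα (by linarith : 1 < p) ht
      (volume_real_pos_of_isOpen isOpen_annulus ⟨x, hx⟩ le_rfl)
      (fun r hr => by rw [hcon r hr, mul_one]) hadm.1.memH1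
    rw [hQ] at h1
    linarith
  obtain ⟨h1, h2⟩ := hz.crosses_one hα hαβ (by linarith) hu.memCone.nonneg hu.memCone.monotoneOn
    hne0 hne1
  exact ⟨z, hz, hα, hαβ, hβ, hp, hu.memCone.nonneg, hu.memCone.monotoneOn, h1, h2⟩

end RadialNeumann

theorem mainTheorem6 (N : ℕ) (hN : 3 ≤ N) (α β : ℝ) (hα : 0 ≤ α) (hαβ : α < β) (hβ : β ≤ 1) :
    ∃ p₀ : ℝ, 1 < p₀ ∧ ∀ p : ℝ, p₀ < p →
      ∀ u : ℝ → ℝ, RadialNeumann.IsIncreasingSolution N α β p u →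
        ∀ v : ℝ → ℝ,
          RadialNeumann.SolvesRadialNeumann N α β (fun r => p * u r ^ (p - 1) * v r) v →
            ∀ r ∈ Set.Icc α β, v r = 0 := by
  obtain ⟨k, rfl⟩ := Nat.exists_eq_add_of_le' hN
  obtain ⟨p₁, hp₁⟩ := RadialNeumann.exists_forall_kernel_eq_zero k hα hαβ hβ
  obtain ⟨p₂, hp₂⟩ :=
    RadialNeumann.exists_forall_cPlus_lt (N := k + 3) (by omega) hα hαβ hβ
  refine ⟨max 2 (max p₁ p₂), lt_of_lt_of_le (by norm_num) (le_max_left _ _),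
    fun p hp u hu v hv => ?_⟩
  have hp2 : 2 ≤ p := (le_max_left _ _).trans hp.le
  have h1 : p₁ ≤ p := ((le_max_left _ _).trans (le_max_right _ _)).trans hp.le
  have h2 : p₂ ≤ p := ((le_max_right _ _).trans (le_max_right _ _)).trans hp.le
  obtain ⟨z, hz⟩ := hu.exists_layerSolution hα hαβ hβ hp2 (by omega) (hp₂ p h2)
  have hf : ContinuousOn (fun r => p * u r ^ (p - 1) * v r) (Icc α β) :=
    (continuousOn_const.mul
      (hu.memCone.continuousOn.rpow_const fun _ _ => Or.inr (by linarith))).mul hv.continuousOn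
  obtain ⟨y, hy⟩ := hv.exists_flow hα hαβ hβ hf
  exact hp₁ p h1 u z v y hz hy
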